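/- For $d \ge 0$, a $d$-polytope is the convex hull of a finite point set in $\mathbb{R}^d$ whose affine hull is $\mathbb{R}^d$. A face of a $d$-polytope $P$ is either $P$ itself or a set $P \cap H$, where $H$ is a hyperplane not meeting the interior of $P$ (so the empty set is a face for $d\ge 1$); a $k$-face is a nonempty face whose affine hull has dimension $k$. Let $\mathscr{F}(P)$ be the set of all faces of $P$ ordered by containment, and for $0 \le a \le b < d$ let $\mathscr{F}_a^b(P)$ be its subposet of all $k$-faces with $a \le k \le b$. In particular, $\mathscr{F}_0^{d-3}(P)$ is the $(d-3)$-skeleton and $\mathscr{F}_2^{d-1}(P)$ is the dual $(d-3)$-skeleton of $P$. For $d \ge 3$, with $e_1,\dots,e_d$ the standard basis of $\mathbb{R}^d$, let $W$ be the convex hull of the $(d-1)$-dimensional cross-polytopes with vertex sets $\{\pm e_1,\dots,\pm e_{d-1}\}$ and $\{e_1,\, 2e_d-e_1,\, e_d\pm e_2,\dots,e_d\pm e_{d-1}\}$, a wedge of two cross-polytopes sharing the single vertex $e_1$. Let $P_d$ be the convex hull of the points obtained from the vertices of $W$ by moving $2e_d-e_1$ to $e_d-e_1$, and let $Q_d$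 be the convex hull of the points obtained from the vertices of $W$ by moving $e_d+e_2$ to $\tfrac12 e_d+e_2$; that is, $$P_d=\operatorname{conv}\{\pm e_1,\dots,\pm e_{d-1},\ e_d-e_1,\ e_d\pm e_2,\dots,e_d\pm e_{d-1}\},$$ $$Q_d=\operatorname{conv}\{\pm e_1,\dots,\pm e_{d-1},\ 2e_d-e_1,\ \tfrac12 e_d+e_2,\ e_d-e_2,\ e_d\pm e_3,\dots,e_d\pm e_{d-1}\}.$$ **Theorem.** For every $d \ge 3$, $P_d$ and $Q_d$ are $d$-polytopes such that $$\mathscr{F}_0^{d-3}(P_d)\cong\mathscr{F}_0^{d-3}(Q_d),\qquad \mathscr{F}_2^{d-1}(P_d)\cong\mathscr{F}_2^{d-1}(Q_d),\qquad \mathscr{F}(P_d)\not\cong\mathscr{F}(Q_d)$$ as posets. Moreover (a negative answer to Samper's question), a 4-polytope is in general not determined by its vertex-edge graph together with its facet-ridge graph: there exist 4-polytopes $P$ and $Q$ with isomorphic vertex-edge graphs and isomorphic facet-ridge graphs but $\mathscr{F}(P)\not\cong\mathscr{F}(Q)$. Here two distinct vertices are adjacent in the vertex-edge graph if some edge (1-face)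 contains both, and two distinct facets (3-faces) are adjacent in the facet-ridge graph if they contain a common ridge (2-face). -/

import Mathlib

/-- A `d`-polytope: the convex hull of a finite point set in `ℝ^d` whose affine hull is `ℝ^d`. -/
def IsPolytope {d : ℕ} (P : Set (EuclideanSpace ℝ (Fin d))) : Prop :=
  ∃ S : Set (EuclideanSpace ℝ (Fin d)),
    S.Finite ∧ affineSpan ℝ S = ⊤ ∧ P = convexHull ℝ S

/-- A face of `P` is either `P` itself or `P ∩ H`, where `H = {x | ⟪a, x⟫ = c}` (with `a ≠ 0`) is a
hyperplane that does not meet the interior of `P`. The empty face is included. -/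
def IsFace {d : ℕ} (P G : Set (EuclideanSpace ℝ (Fin d))) : Prop :=
  G = P ∨ ∃ (a : EuclideanSpace ℝ (Fin d)) (c : ℝ), a ≠ 0 ∧
    Disjoint {x | inner ℝ a x = c} (interior P) ∧ G = P ∩ {x | inner ℝ a x = c}

/-- A `k`-face of `P`: a face whose affine hull is `k`-dimensional. The empty face, of dimension
`-1`, is not a `k`-face for any `k : ℕ`. -/
def IsKFace {d : ℕ} (P : Set (EuclideanSpace ℝ (Fin d))) (k : ℕ)
    (G : Set (EuclideanSpace ℝ (Fin d))) : Prop :=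
  IsFace P G ∧ G.Nonempty ∧ Module.finrank ℝ (affineSpan ℝ G).direction = k

/-- The face poset of `P`: all faces of `P`, ordered by containment. -/
abbrev FacePoset {d : ℕ} (P : Set (EuclideanSpace ℝ (Fin d))) : Type :=
  {G : Set (EuclideanSpace ℝ (Fin d)) // IsFace P G}

/-- The `(a, b)`-skeleton of `P`: all `k`-faces of `P` with `a ≤ k ≤ b`, ordered by containment. -/
abbrev Skeleton {d : ℕ} (P : Set (EuclideanSpace ℝ (Fin d))) (a b : ℕ) : Type :=
  {G : Set (EuclideanSpace ℝ (Fin d)) // ∃ k, a ≤ k ∧ k ≤ b ∧ IsKFace P k G}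

/-- The vertex-edge graph of `P`: two distinct vertices are adjacent if some edge contains both. -/
def vertexEdgeGraph {d : ℕ} (P : Set (EuclideanSpace ℝ (Fin d))) :
    SimpleGraph {v : Set (EuclideanSpace ℝ (Fin d)) // IsKFace P 0 v} where
  Adj u v := u ≠ v ∧ ∃ e, IsKFace P 1 e ∧ u.1 ⊆ e ∧ v.1 ⊆ e
  symm := ⟨fun _ _ ⟨hne, e, he, hu, hv⟩ => ⟨hne.symm, e, he, hv, hu⟩⟩
  loopless := ⟨fun _ h => h.1 rfl⟩

/-- The facet-ridge graph (dual graph) of a `d`-polytope `P`: two distinct facets are adjacent if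
some ridge is contained in both. -/
def facetRidgeGraph {d : ℕ} (P : Set (EuclideanSpace ℝ (Fin d))) :
    SimpleGraph {F : Set (EuclideanSpace ℝ (Fin d)) // IsKFace P (d - 1) F} where
  Adj F G := F ≠ G ∧ ∃ R, IsKFace P (d - 2) R ∧ R ⊆ F.1 ∧ R ⊆ G.1
  symm := ⟨fun _ _ ⟨hne, R, hR, hF, hG⟩ => ⟨hne.symm, R, hR, hG, hF⟩⟩
  loopless := ⟨fun _ h => h.1 rfl⟩

/-- The standard basis vector `e_k` of `ℝ^d`, with `k = 1, …, d`. -/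
noncomputable def stdVec (d k : ℕ) : EuclideanSpace ℝ (Fin d) :=
  WithLp.toLp 2 (fun i : Fin d => if (i : ℕ) + 1 = k then (1 : ℝ) else 0)

/-- The vertices `± e_1, …, ± e_{d-1}` of the `(d-1)`-dimensional cross-polytope `F`. -/
def baseVertices (d : ℕ) : Set (EuclideanSpace ℝ (Fin d)) :=
  {v | ∃ i, 1 ≤ i ∧ i ≤ d - 1 ∧ (v = stdVec d i ∨ v = -stdVec d i)}

/-- The vertices `e_1`, `2 e_d - e_1`, `e_d ± e_2, …, e_d ± e_{d-1}` of the `(d-1)`-dimensional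
cross-polytope `F'`. -/
def topVertices (d : ℕ) : Set (EuclideanSpace ℝ (Fin d)) :=
  {stdVec d 1, (2 : ℝ) • stdVec d d - stdVec d 1} ∪
    {v | ∃ i, 2 ≤ i ∧ i ≤ d - 1 ∧ (v = stdVec d d + stdVec d i ∨ v = stdVec d d - stdVec d i)}

/-- The vertices of the wedge `W = conv (F ∪ F')`; the cross-polytopes `F` and `F'` share only the
vertex `e_1`. -/
def wedgeVertices (d : ℕ) : Set (EuclideanSpace ℝ (Fin d)) :=
  baseVertices d ∪ topVertices d

/-- The perturbation `P` of the wedge: the vertex `2 e_d - e_1` is moved to `e_d - e_1`. -/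
def polytopeP (d : ℕ) : Set (EuclideanSpace ℝ (Fin d)) :=
  convexHull ℝ (insert (stdVec d d - stdVec d 1)
    (wedgeVertices d \ {(2 : ℝ) • stdVec d d - stdVec d 1}))

/-- The perturbation `Q` of the wedge: the vertex `e_d + e_2` is moved to `(1/2) e_d + e_2`. -/
def polytopeQ (d : ℕ) : Set (EuclideanSpace ℝ (Fin d)) :=
  convexHull ℝ (insert ((1 / 2 : ℝ) • stdVec d d + stdVec d 2)
    (wedgeVertices d \ {stdVec d d + stdVec d 2}))

/-! Write `d = n + 3` and points as `(y, t)`, coordinates counted from `0`. Both polytopes consist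
of the points over the cross-polytope `∑ |y i| ≤ 1` that lie between the base `t = 0` and a concave
roof. The roof is the minimum of two affine functions that differ only in the coefficient of one
coordinate `y k`, and it touches the base only at the apex `e_1`. The crease `y k = 0` cuts the roof
into two facets. Here `k = 0` for the first polytope and `k = 1` for the second, and all
combinatorics depend on `k` alone.

Once points and facet inequalities are matched (`IsRoof.isDoubleDescription`), the faces are the
extents of the point-facet incidence relation (`IsDoubleDescription.facePosetIso`). They are
simplices of the base or the roof, walls over such simplices, and a few large faces. Dimensions need
no affine hulls: unit-step chains through every face leave only one possible value
(`WedgeFace.eq_rank_of_strictMono`).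

Low skeleta agree because faces of dimension at most `d - 3` do not see the crease. Dual skeleta
agree because base and roof share only one vertex: the facets through a face of dimension at least
two can be described without mentioning the apex, so swapping the coordinates `0` and `1` on facets
is an isomorphism there, although it does not fix the apex. The full lattices differ. For `k = 0`
the half of the roof away from the apex misses the base, and just one facet meets all facets; for `k
= 1` the base and a half of the roof both do. -/

open Set

/-! ### Polytopes given by points and inequalities; supporting hyperplanes. -/

/-- The points `p v` and the inequalities `⟪a j, x⟫ ≤ c j` describe the same full-dimensional
polytope, `Inc v j` records which points are tight for which inequalities, and no point is tight
for all of them. -/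
structure IsDoubleDescription {d : ℕ} {V J : Type*} (p : V → EuclideanSpace ℝ (Fin d))
    (a : J → EuclideanSpace ℝ (Fin d)) (c : J → ℝ) (Inc : V → J → Prop) : Prop where
  mem_iff : ∀ x, x ∈ convexHull ℝ (range p) ↔ ∀ j, inner ℝ (a j) x ≤ c j
  inc_iff : ∀ v j, Inc v j ↔ inner ℝ (a j) (p v) = c j
  span_eq_top : affineSpan ℝ (range p) = ⊤
  exists_not_inc : ∀ v, ∃ j, ¬ Inc v j

theorem mem_convexHull_range_iff_exists_weights {E V : Type*} [AddCommGroup E] [Module ℝ E]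
    [Fintype V] (p : V → E) (x : E) :
    x ∈ convexHull ℝ (range p) ↔
      ∃ w : V → ℝ, (∀ v, 0 ≤ w v) ∧ ∑ v, w v = 1 ∧ ∑ v, w v • p v = x := by
  constructor
  · intro hx
    have hsub : convexHull ℝ (range p) ⊆
        {x | ∃ w : V → ℝ, (∀ v, 0 ≤ w v) ∧ ∑ v, w v = 1 ∧ ∑ v, w v • p v = x} := by
      classical
      refine convexHull_min ?_ ?_
      · rintro _ ⟨v, rfl⟩
        refine ⟨Pi.single v 1, fun u => ?_, by simp, ?_⟩
        · by_cases h : u = v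
          · subst h; simp
          · simp [h]
        · rw [Finset.sum_eq_single v] <;> simp +contextual
      · rintro x ⟨w, h0, h1, rfl⟩ y ⟨w', h0', h1', rfl⟩ s t hs ht hst
        refine ⟨fun v => s * w v + t * w' v, fun v => ?_, ?_, ?_⟩
        · have := h0 v; have := h0' v; positivity
        · rw [Finset.sum_add_distrib, ← Finset.mul_sum, ← Finset.mul_sum, h1, h1']; linarith
        · simp [add_smul, Finset.sum_add_distrib, Finset.smul_sum, mul_smul]
    exact hsub hx
  · rintro ⟨w, h0, h1, rfl⟩
    exact (convex_convexHull ℝ _).sum_mem (fun v _ => h0 v) h1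
      fun v _ => subset_convexHull ℝ _ ⟨v, rfl⟩

/-- A point of a polytope at which some valid inequalities are tight is a convex combination of
those generating points at which they are tight. -/
theorem mem_convexHull_image_of_tight {E V J : Type*} [NormedAddCommGroup E]
    [InnerProductSpace ℝ E] [Fintype V]
    {p : V → E} {a : J → E} {c : J → ℝ} {I : Set J} {x : E}
    (hle : ∀ j ∈ I, ∀ v, inner ℝ (a j) (p v) ≤ c j) (hx : x ∈ convexHull ℝ (range p))
    (heq : ∀ j ∈ I, inner ℝ (a j) x = c j) :
    x ∈ convexHull ℝ (p '' {v | ∀ j ∈ I, inner ℝ (a j) (p v) = c j}) := by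
  classical
  obtain ⟨w, h0, h1, rfl⟩ := (mem_convexHull_range_iff_exists_weights p x).1 hx
  -- The weighted slacks at the generators are nonnegative and sum to the slack at `x`, which is
  -- zero, so positive weight forces tightness.
  have key : ∀ v, w v ≠ 0 → ∀ j ∈ I, inner ℝ (a j) (p v) = c j := by
    intro v hv j hj
    have hsum : ∑ u, w u * (c j - inner ℝ (a j) (p u)) = 0 := by
      have := heq j hj
      rw [inner_sum] at this
      simp only [inner_smul_right] at this
      simp only [mul_sub, Finset.sum_sub_distrib, ← Finset.sum_mul, h1, this]
      ring
    have := (Finset.sum_eq_zero_iff_of_nonneg fun u _ =>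
      mul_nonneg (h0 u) (sub_nonneg.2 (hle j hj u))).1 hsum v (Finset.mem_univ v)
    rcases mul_eq_zero.1 this with h | h
    · exact absurd h hv
    · linarith
  have e1 : ∑ v with w v ≠ 0, w v = 1 := by rw [Finset.sum_filter_ne_zero, h1]
  have e2 : ∑ v with w v ≠ 0, w v • p v = ∑ v, w v • p v := by
    rw [Finset.sum_filter]
    refine Finset.sum_congr rfl fun v _ => ?_
    by_cases h : w v = 0 <;> simp [h]
  rw [← e2]
  refine (convex_convexHull ℝ _).sum_mem (fun v _ => h0 v) e1 fun v hv => subset_convexHull ℝ _ ?_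
  exact ⟨v, key v (by simpa using hv), rfl⟩

/-- A nonzero linear functional has no maximum in the interior of a set. -/
theorem inner_lt_of_mem_interior {E : Type*} [NormedAddCommGroup E] [InnerProductSpace ℝ E]
    {P : Set E} {a x : E} {c : ℝ} (ha : a ≠ 0) (hP : ∀ y ∈ P, inner ℝ a y ≤ c)
    (hx : x ∈ interior P) : inner ℝ a x < c := by
  obtain ⟨ε, hε, hball⟩ := Metric.isOpen_iff.1 isOpen_interior x hx
  have hn : 0 < ‖a‖ := norm_pos_iff.2 ha
  -- The displacement has length `ε / 2`, so the point stays in the ball while the functional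
  -- strictly increases.
  have hy : x + (ε / (2 * ‖a‖)) • a ∈ P := by
    refine interior_subset (hball ?_)
    rw [Metric.mem_ball, dist_eq_norm, add_sub_cancel_left, norm_smul, Real.norm_of_nonneg
      (by positivity)]
    field_simp
    linarith
  have := hP _ hy
  rw [inner_add_right, inner_smul_right, real_inner_self_eq_norm_sq] at this
  have : 0 < ε / (2 * ‖a‖) * ‖a‖ ^ 2 := by positivity
  linarith

/-- A hyperplane missing the nonempty interior of a convex set has the set on one side. -/
theorem forall_inner_le_or_ge_of_disjoint_interior {E : Type*} [NormedAddCommGroup E]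
    [InnerProductSpace ℝ E] {P : Set E} (hP : Convex ℝ P) (hne : (interior P).Nonempty)
    {a : E} {c : ℝ} (h : Disjoint {x | inner ℝ a x = c} (interior P)) :
    (∀ x ∈ P, inner ℝ a x ≤ c) ∨ ∀ x ∈ P, c ≤ inner ℝ a x := by
  have hcont : Continuous fun x : E => inner ℝ a x := by fun_prop
  have hcl : P ⊆ closure (interior P) := by
    rw [hP.closure_interior_eq_closure_of_nonempty_interior hne]; exact subset_closure
  have hside : (∀ x ∈ interior P, inner ℝ a x ≤ c) ∨ ∀ x ∈ interior P, c ≤ inner ℝ a x := by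
    by_contra! hcon
    obtain ⟨⟨x, hx, hxc⟩, y, hy, hyc⟩ := hcon
    have hpre : IsPreconnected (interior P) := hP.interior.isPreconnected
    obtain ⟨z, hz, hzc⟩ := hpre.intermediate_value hy hx hcont.continuousOn ⟨hyc.le, hxc.le⟩
    exact Set.disjoint_left.1 h hzc hz
  rcases hside with hs | hs
  · exact Or.inl fun x hx =>
      closure_minimal (t := {x | inner ℝ a x ≤ c}) hs (isClosed_le hcont continuous_const) (hcl hx)
  · exact Or.inr fun x hx =>
      closure_minimal (t := {x | c ≤ inner ℝ a x}) hs (isClosed_le continuous_const hcont) (hcl hx)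

theorem IsFace.subset {d : ℕ} {P G : Set (EuclideanSpace ℝ (Fin d))} (h : IsFace P G) : G ⊆ P := by
  rcases h with rfl | ⟨a, c, -, -, rfl⟩
  · exact Subset.rfl
  · exact inter_subset_left

/-- The dimension of a set plus one, with value `0` for the empty set. -/
noncomputable def dimSucc {d : ℕ} (G : Set (EuclideanSpace ℝ (Fin d))) : ℕ :=
  open Classical in
  if G.Nonempty then Module.finrank ℝ (affineSpan ℝ G).direction + 1 else 0

theorem isKFace_iff_dimSucc {d : ℕ} {P G : Set (EuclideanSpace ℝ (Fin d))} (hG : IsFace P G)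
    (k : ℕ) : IsKFace P k G ↔ dimSucc G = k + 1 := by
  unfold IsKFace dimSucc
  by_cases h : G.Nonempty <;> simp [h, hG]

/-- If the affine hulls agreed, a point of `G'` outside `G` would lie in the hyperplane that cuts
`G` out of `P`, hence in `G`. The shift by one lets the empty face take part. -/
theorem dimSucc_lt_of_ssubset {d : ℕ} {P G G' : Set (EuclideanSpace ℝ (Fin d))} (hG : IsFace P G)
    (hG' : IsFace P G') (h : G ⊂ G') : dimSucc G < dimSucc G' := by
  obtain ⟨x, hx, hxG⟩ := exists_of_ssubset h
  have hne' : G'.Nonempty := ⟨x, hx⟩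
  by_cases hne : G.Nonempty
  · rw [dimSucc, dimSucc, if_pos hne, if_pos hne', add_lt_add_iff_right]
    apply Submodule.finrank_lt_finrank_of_lt
    refine AffineSubspace.direction_lt_of_nonempty ?_ (hne.mono (subset_affineSpan ℝ G))
    refine lt_of_le_of_ne (affineSpan_mono ℝ h.1) fun heq => hxG ?_
    rcases hG with rfl | ⟨a, c, -, -, rfl⟩
    · exact hG'.subset hx
    · obtain ⟨y, hy⟩ := hne
      refine ⟨hG'.subset hx, ?_⟩
      have hx' : x ∈ affineSpan ℝ (P ∩ {x | inner ℝ a x = c}) :=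
        heq ▸ subset_affineSpan ℝ G' hx
      have hle : affineSpan ℝ (P ∩ {x | inner ℝ a x = c}) ≤
          AffineSubspace.mk' y (LinearMap.ker (innerₛₗ ℝ a)) := by
        refine affineSpan_le.2 fun z hz => ?_
        have h1 : inner ℝ a z = c := hz.2
        have h2 : inner ℝ a y = c := hy.2
        simp [AffineSubspace.mem_mk', inner_sub_right, h1, h2]
      have := hle hx'
      have h2 : inner ℝ a y = c := hy.2
      simp only [AffineSubspace.mem_mk', vsub_eq_sub, LinearMap.mem_ker, innerₛₗ_apply_apply,
        inner_sub_right, h2] at this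
      exact sub_eq_zero.1 this
  · rw [dimSucc, dimSucc, if_neg hne, if_pos hne']; omega

/-! ### Faces of a polytope as extents of the incidence relation. -/

namespace IsDoubleDescription

variable {d : ℕ} {V J : Type*} {p : V → EuclideanSpace ℝ (Fin d)}
  {a : J → EuclideanSpace ℝ (Fin d)} {c : J → ℝ} {Inc : V → J → Prop}

theorem inner_le (h : IsDoubleDescription p a c Inc) (v : V) (j : J) :
    inner ℝ (a j) (p v) ≤ c j :=
  (h.mem_iff _).1 (subset_convexHull ℝ _ ⟨v, rfl⟩) j

theorem interior_nonempty (h : IsDoubleDescription p a c Inc) :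
    (interior (convexHull ℝ (range p))).Nonempty :=
  interior_convexHull_nonempty_iff_affineSpan_eq_top.2 h.span_eq_top

theorem isPolytope [Finite V] (h : IsDoubleDescription p a c Inc) :
    IsPolytope (convexHull ℝ (range p)) :=
  ⟨range p, finite_range p, h.span_eq_top, rfl⟩

theorem setOf_tight_eq (h : IsDoubleDescription p a c Inc) (I : Set J) :
    {v | ∀ j ∈ I, inner ℝ (a j) (p v) = c j} = lowerPolar Inc I := by
  ext v
  simp [mem_lowerPolar_iff, h.inc_iff]

theorem isExtent_empty (h : IsDoubleDescription p a c Inc) : Order.IsExtent Inc ∅ := by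
  refine ⟨univ, eq_empty_of_forall_notMem fun v hv => ?_⟩
  obtain ⟨j, hj⟩ := h.exists_not_inc v
  exact hj (hv (mem_univ j))

variable [Fintype V]

theorem convexHull_image_lowerPolar (h : IsDoubleDescription p a c Inc) (I : Set J) :
    convexHull ℝ (p '' lowerPolar Inc I) =
      {x ∈ convexHull ℝ (range p) | ∀ j ∈ I, inner ℝ (a j) x = c j} := by
  refine Subset.antisymm (convexHull_min ?_ ?_) fun x hx => ?_
  · rintro _ ⟨v, hv, rfl⟩
    exact ⟨subset_convexHull ℝ _ ⟨v, rfl⟩, fun j hj => (h.inc_iff v j).1 (hv hj)⟩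
  · rintro x ⟨hx, hxI⟩ y ⟨hy, hyI⟩ s t hs ht hst
    refine ⟨convex_convexHull ℝ _ hx hy hs ht hst, fun j hj => ?_⟩
    rw [inner_add_right, inner_smul_right, inner_smul_right, hxI j hj, hyI j hj, ← add_mul, hst,
      one_mul]
  · rw [← h.setOf_tight_eq]
    exact mem_convexHull_image_of_tight (fun j _ v => h.inner_le v j) hx.1 hx.2

/-- An extent is defined by equalities, and these persist on its convex hull; so a face remembers
its labels, and distinct extents give distinct faces. -/
theorem preimage_convexHull_image (h : IsDoubleDescription p a c Inc) {A : Set V}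
    (hA : Order.IsExtent Inc A) : p ⁻¹' convexHull ℝ (p '' A) = A := by
  obtain ⟨I, rfl⟩ := hA
  rw [h.convexHull_image_lowerPolar]
  ext v
  simp only [mem_preimage, mem_ofPred_eq, mem_lowerPolar_iff, h.inc_iff]
  exact ⟨fun hv => hv.2, fun hv => ⟨subset_convexHull ℝ _ ⟨v, rfl⟩, hv⟩⟩

/-- Adding the inequalities indexed by `I` gives one valid inequality, tight exactly where all of
them are. The empty face needs a separate hyperplane beyond the polytope, and `0 < d` supplies a
nonzero normal for it. -/
theorem isFace_convexHull_image [Fintype J] (h : IsDoubleDescription p a c Inc) (hd : 0 < d)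
    {A : Set V} (hA : Order.IsExtent Inc A) :
    IsFace (convexHull ℝ (range p)) (convexHull ℝ (p '' A)) := by
  classical
  obtain ⟨I, rfl⟩ := hA
  have hconv := h.convexHull_image_lowerPolar I
  rw [hconv]
  set P := convexHull ℝ (range p) with hP
  rcases eq_empty_or_nonempty {x ∈ P | ∀ j ∈ I, inner ℝ (a j) x = c j} with he | ⟨x₀, hx₀, hx₀I⟩
  · rw [he]
    right
    let e : EuclideanSpace ℝ (Fin d) := EuclideanSpace.single ⟨0, hd⟩ 1
    obtain ⟨m, hm⟩ := ((finite_range p).isCompact_convexHull (𝕜 := ℝ)).bddAbove_image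
      (f := fun x => inner ℝ e x) (by fun_prop)
    have hlt : ∀ x ∈ P, inner ℝ e x < m + 1 := fun x hx =>
      (hm ⟨x, hx, rfl⟩).trans_lt (lt_add_one m)
    refine ⟨e, m + 1, by simp [e], ?_, ?_⟩
    · exact disjoint_left.2 fun x hx hxi => (hlt x (interior_subset hxi)).ne hx
    · symm
      exact eq_empty_of_forall_notMem fun x hx => (hlt x hx.1).ne hx.2
  · have hle : ∀ x ∈ P, ∀ j, inner ℝ (a j) x ≤ c j := fun x hx => (h.mem_iff x).1 hx
    have hset : {x ∈ P | ∀ j ∈ I, inner ℝ (a j) x = c j} =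
        P ∩ {x | inner ℝ (∑ j with j ∈ I, a j) x = ∑ j with j ∈ I, c j} := by
      ext x
      simp only [mem_ofPred_eq, mem_inter_iff, sum_inner]
      refine and_congr_right fun hx => ?_
      rw [Finset.sum_eq_sum_iff_of_le fun j _ => hle x hx j]
      simp
    -- A zero normal defines no hyperplane; then the equation reads `0 = 0` and the face is the
    -- whole polytope. This includes `I = ∅`.
    by_cases ha : ∑ j with j ∈ I, a j = 0
    · left
      have hc : ∑ j with j ∈ I, c j = 0 := by
        have : x₀ ∈ P ∩ {x | inner ℝ (∑ j with j ∈ I, a j) x = ∑ j with j ∈ I, c j} :=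
          hset ▸ ⟨hx₀, hx₀I⟩
        simpa [ha] using this.2.symm
      rw [hset, ha, hc]
      simp
    · right
      refine ⟨_, _, ha, disjoint_left.2 fun x hx hxi => ?_, hset⟩
      refine (inner_lt_of_mem_interior ha (fun y hy => ?_) hxi).ne hx
      rw [sum_inner]
      exact Finset.sum_le_sum fun j _ => hle y hy j

/-- The extent is the closure of the set `A` of generators on the hyperplane. Their barycentre `y`
is strict for every inequality not tight on all of `A`, so from any `x` in the hull of the closure
one can move slightly beyond `y` inside the polytope. If `x` were below the maximum `m`, that
further point would be above it. -/
theorem exists_isExtent_of_exposed [Fintype J] (h : IsDoubleDescription p a c Inc)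
    {b : EuclideanSpace ℝ (Fin d)} {m : ℝ} (hle : ∀ x ∈ convexHull ℝ (range p), inner ℝ b x ≤ m) :
    ∃ A, Order.IsExtent Inc A ∧
      convexHull ℝ (range p) ∩ {x | inner ℝ b x = m} = convexHull ℝ (p '' A) := by
  classical
  set P := convexHull ℝ (range p) with hP
  rcases eq_empty_or_nonempty (P ∩ {x | inner ℝ b x = m}) with he | hne
  · exact ⟨∅, h.isExtent_empty, by simp [he]⟩
  set A : Set V := {v | inner ℝ b (p v) = m} with hAdef
  have hGA : P ∩ {x | inner ℝ b x = m} ⊆ convexHull ℝ (p '' A) := fun x hx => by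
    have := mem_convexHull_image_of_tight (p := p) (a := fun _ : Unit => b) (c := fun _ => m)
      (I := univ) (x := x) (fun _ _ v => hle _ (subset_convexHull ℝ _ ⟨v, rfl⟩)) hx.1
      (fun _ _ => hx.2)
    simpa [hAdef] using this
  have hAne : A.Nonempty := by
    obtain ⟨x, hx⟩ := hne
    by_contra hcon
    rw [not_nonempty_iff_eq_empty] at hcon
    simpa [hcon] using hGA hx
  let s : Finset V := Finset.univ.filter (· ∈ A)
  have hs : s.Nonempty := by
    obtain ⟨v, hv⟩ := hAne
    exact ⟨v, by simp [s, hv]⟩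
  have hcard : (0 : ℝ) < s.card := by exact_mod_cast hs.card_pos
  -- the barycentre of the generating points in the exposed face
  let y := ∑ v ∈ s, ((s.card : ℝ)⁻¹) • p v
  have hyP : y ∈ P := by
    refine (convex_convexHull ℝ _).sum_mem (fun v _ => by positivity) ?_
      fun v _ => subset_convexHull ℝ _ ⟨v, rfl⟩
    simp [hcard.ne']
  have hyb : inner ℝ b y = m := by
    simp only [y, inner_sum, inner_smul_right]
    rw [Finset.sum_congr rfl (g := fun _ => (s.card : ℝ)⁻¹ * m) fun v hv => by
      rw [show inner ℝ b (p v) = m by simpa [s, A] using hv]]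
    simp [hcard.ne']
  have hylt : ∀ j, j ∉ upperPolar Inc A → inner ℝ (a j) y < c j := by
    intro j hj
    simp only [mem_upperPolar_iff, not_forall] at hj
    obtain ⟨v, hv, hvj⟩ := hj
    rw [h.inc_iff] at hvj
    have hvs : v ∈ s := by simpa [s] using hv
    calc inner ℝ (a j) y = ∑ v ∈ s, (s.card : ℝ)⁻¹ * inner ℝ (a j) (p v) := by
          simp [y, inner_sum, inner_smul_right]
      _ < ∑ v ∈ s, (s.card : ℝ)⁻¹ * c j := by
          refine Finset.sum_lt_sum (fun u _ => ?_) ⟨v, hvs, ?_⟩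
          · exact mul_le_mul_of_nonneg_left (h.inner_le u j) (by positivity)
          · exact mul_lt_mul_of_pos_left (lt_of_le_of_ne (h.inner_le v j) hvj) (by positivity)
      _ = c j := by simp [hcard.ne']
  refine ⟨lowerPolar Inc (upperPolar Inc A), Order.isExtent_lowerPolar, ?_⟩
  refine Subset.antisymm (hGA.trans (convexHull_mono (image_mono
    (subset_lowerPolar_upperPolar _ _)))) ?_
  rw [h.convexHull_image_lowerPolar]
  rintro x ⟨hxP, hxI⟩
  refine ⟨hxP, ?_⟩
  -- extend the segment from `x` through `y` a little inside `P`
  have hev : ∀ᶠ ε in nhdsWithin (0 : ℝ) (Ioi 0), ∀ j, inner ℝ (a j) (y + ε • (y - x)) ≤ c j := by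
    rw [Filter.eventually_all]
    intro j
    by_cases hj : j ∈ upperPolar Inc A
    · refine Filter.Eventually.of_forall fun ε => ?_
      have h1 : inner ℝ (a j) y = c j := by
        simp only [y, inner_sum, inner_smul_right]
        rw [Finset.sum_congr rfl (g := fun _ => (s.card : ℝ)⁻¹ * c j) fun v hv => by
          rw [(h.inc_iff v j).1 (hj (by simpa [s] using hv))]]
        simp [hcard.ne']
      rw [inner_add_right, inner_smul_right, inner_sub_right, h1, hxI j hj]
      simp
    · have hc : ContinuousAt (fun ε : ℝ => inner ℝ (a j) (y + ε • (y - x))) 0 := by fun_prop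
      have : ∀ᶠ ε in nhds (0 : ℝ), inner ℝ (a j) (y + ε • (y - x)) < c j :=
        hc.eventually_lt continuousAt_const (by simpa using hylt j hj)
      exact (this.filter_mono nhdsWithin_le_nhds).mono fun ε hε => hε.le
  obtain ⟨ε, hε, hε0⟩ := (hev.and self_mem_nhdsWithin).exists
  have hε0 : 0 < ε := hε0
  have := hle _ ((h.mem_iff _).2 hε)
  rw [inner_add_right, inner_smul_right, inner_sub_right, hyb] at this
  have hxm := hle x hxP
  refine le_antisymm hxm ?_
  by_contra hcon
  have : 0 < ε * (m - inner ℝ b x) := mul_pos hε0 (by linarith [not_le.1 hcon])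
  linarith

theorem isFace_iff [Fintype J] (h : IsDoubleDescription p a c Inc) (hd : 0 < d)
    {G : Set (EuclideanSpace ℝ (Fin d))} : IsFace (convexHull ℝ (range p)) G ↔
      ∃ A, Order.IsExtent Inc A ∧ G = convexHull ℝ (p '' A) := by
  constructor
  · rintro (rfl | ⟨b, m, -, hdis, rfl⟩)
    · exact ⟨univ, Order.IsExtent.univ, by rw [image_univ]⟩
    · rcases forall_inner_le_or_ge_of_disjoint_interior (convex_convexHull ℝ _)
        h.interior_nonempty hdis with hle | hge
      · exact h.exists_isExtent_of_exposed hle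
      · have := h.exists_isExtent_of_exposed (b := -b) (m := -m)
          (fun x hx => by simpa using hge x hx)
        simpa using this
  · rintro ⟨A, hA, rfl⟩
    exact h.isFace_convexHull_image hd hA

/-- The face poset of a polytope is the concept lattice of its incidence relation. -/
noncomputable def facePosetIso [Fintype J] (h : IsDoubleDescription p a c Inc) (hd : 0 < d) :
    Concept V J Inc ≃o FacePoset (convexHull ℝ (range p)) where
  toFun x := ⟨convexHull ℝ (p '' x.extent), h.isFace_convexHull_image hd x.isExtent_extent⟩
  invFun G := Concept.ofIsExtent Inc (p ⁻¹' G.1) <| by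
    obtain ⟨A, hA, hG⟩ := (h.isFace_iff hd).1 G.2
    rw [hG, h.preimage_convexHull_image hA]
    exact hA
  left_inv x := Concept.ext (h.preimage_convexHull_image x.isExtent_extent)
  right_inv G := by
    obtain ⟨A, hA, hG⟩ := (h.isFace_iff hd).1 G.2
    apply Subtype.ext
    change convexHull ℝ (p '' (p ⁻¹' G.1)) = G.1
    rw [hG, h.preimage_convexHull_image hA]
  map_rel_iff' {x y} := by
    change convexHull ℝ (p '' x.extent) ⊆ convexHull ℝ (p '' y.extent) ↔ x.extent ⊆ y.extent
    refine ⟨fun hxy => ?_, fun hxy => convexHull_mono (image_mono hxy)⟩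
    rw [← h.preimage_convexHull_image x.isExtent_extent,
      ← h.preimage_convexHull_image y.isExtent_extent]
    exact preimage_mono hxy

end IsDoubleDescription

/-! ### Combinatorial model of the split wedge. -/

/-- Labels of the points of a split wedge over the cross-polytope of dimension `n + 2`: a signed
coordinate direction, and whether the point belongs to the top. -/
abbrev WedgePoint (n : ℕ) : Type := (Fin (n + 2) × Bool) × Bool

/-- Labels of the facets of a split wedge: the base, the two halves of the roof and the sides. -/
inductive WedgeFacet (n : ℕ) : Type
  | base
  | roof (b : Bool)
  | side (σ : Fin (n + 2) → Bool)

/-- The incidence relation of the wedge whose roof is split along the coordinate `k`. The bottom and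
top points over the apex `(0, true)` coincide. -/
def WedgeInc {n : ℕ} (k : Fin (n + 2)) (v : WedgePoint n) : WedgeFacet n → Prop
  | .base => v.2 = false ∨ v.1 = (0, true)
  | .roof b => (v.2 = true ∨ v.1 = (0, true)) ∧ (v.1.1 = k → v.1.2 = b)
  | .side σ => σ v.1.1 = v.1.2

/-- Combinatorial types of faces of a split wedge. Partial sign vectors stand for simplices in the
boundary of the cross-polytope. -/
inductive WedgeFace (n : ℕ) : Type
  | bot (τ : Fin (n + 2) → Option Bool)
  | top (τ : Fin (n + 2) → Option Bool)
  | side (τ : Fin (n + 2) → Option Bool)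
  | base
  | ridge
  | roof (b : Bool)
  | whole

/-- The number of nonzero entries of a partial sign vector. -/
def supportCard {n : ℕ} (τ : Fin n → Option Bool) : ℕ :=
  (Finset.univ.filter fun i => (τ i).isSome).card

namespace WedgeFace

variable {n : ℕ}

/-- The points of a face. -/
def extent (k : Fin (n + 2)) : WedgeFace n → Set (WedgePoint n)
  | bot τ => {v | τ v.1.1 = some v.1.2 ∧ (v.2 = false ∨ v.1 = (0, true))}
  | top τ => {v | τ v.1.1 = some v.1.2 ∧ (v.2 = true ∨ v.1 = (0, true))}
  | side τ => {v | τ v.1.1 = some v.1.2}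
  | base => {v | v.2 = false ∨ v.1 = (0, true)}
  | ridge => {v | (v.2 = true ∨ v.1 = (0, true)) ∧ v.1.1 ≠ k}
  | roof b => {v | (v.2 = true ∨ v.1 = (0, true)) ∧ (v.1.1 = k → v.1.2 = b)}
  | whole => univ

/-- The dimension of a face plus one. -/
def rank : WedgeFace n → ℕ
  | bot τ => supportCard τ
  | top τ => supportCard τ
  | side τ => supportCard τ + 1
  | base => n + 3
  | ridge => n + 2
  | roof _ => n + 3
  | whole => n + 4

/-- A side face is proper if it does not degenerate to the apex or the empty face. -/
def IsValid : WedgeFace n → Prop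
  | side τ => ∃ i s, τ i = some s ∧ (i, s) ≠ (0, true)
  | _ => True

end WedgeFace

/-! ### Partial sign vectors. -/

section PartialSigns

variable {n : ℕ}

theorem supportCard_update_some {τ : Fin n → Option Bool} {i : Fin n} (s : Bool)
    (h : τ i = none) : supportCard (Function.update τ i (some s)) = supportCard τ + 1 := by
  unfold supportCard
  rw [← Finset.card_insert_of_notMem (a := i) (by simp [h])]
  congr 1
  ext j
  by_cases hj : j = i
  · subst hj; simp
  · simp [hj]

theorem supportCard_update_none {τ : Fin n → Option Bool} {i : Fin n} {s : Bool}
    (h : τ i = some s) : supportCard (Function.update τ i none) + 1 = supportCard τ := by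
  rw [← supportCard_update_some s (Function.update_self i none τ), Function.update_idem, ← h,
    Function.update_eq_self]

theorem supportCard_some (σ : Fin n → Bool) : supportCard (fun i => some (σ i)) = n := by
  simp [supportCard]

theorem exists_eq_none_or (τ : Fin n → Option Bool) :
    (∃ i, τ i = none) ∨ ∃ σ : Fin n → Bool, τ = fun i => some (σ i) := by
  by_cases h : ∃ i, τ i = none
  · exact Or.inl h
  · push Not at h
    choose σ hσ using fun i => Option.ne_none_iff_exists'.1 (h i)
    exact Or.inr ⟨σ, funext hσ⟩

theorem exists_some_of_supportCard_ne_zero {τ : Fin n → Option Bool} (h : supportCard τ ≠ 0) :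
    ∃ i s, τ i = some s := by
  obtain ⟨i, hi⟩ := Finset.card_ne_zero.1 h
  exact ⟨i, Option.isSome_iff_exists.1 (by simpa using hi)⟩

theorem exists_ne_of_two_le_supportCard {τ : Fin n → Option Bool} (h : 2 ≤ supportCard τ)
    (k : Fin n) : ∃ i s, i ≠ k ∧ τ i = some s := by
  obtain ⟨i, hi, hne⟩ := Finset.exists_mem_ne (show 1 < Finset.card _ from h) k
  obtain ⟨s, hs⟩ := Option.isSome_iff_exists.1 (by simpa using hi)
  exact ⟨i, s, hne, hs⟩

theorem supportCard_comp (τ : Fin n → Option Bool) (e : Equiv.Perm (Fin n)) :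
    supportCard (τ ∘ e) = supportCard τ :=
  Finset.card_equiv e (by simp)

/-- A partial sign vector is the intersection of the total sign vectors extending it. -/
theorem forall_extension_iff (τ : Fin n → Option Bool) (i : Fin n) (s : Bool) :
    (∀ σ : Fin n → Bool, (∀ j t, τ j = some t → σ j = t) → σ i = s) ↔ τ i = some s := by
  refine ⟨fun h => ?_, fun h σ hσ => hσ i s h⟩
  rcases hi : τ i with _ | t
  · have := h (Function.update (fun j => (τ j).getD false) i (!s)) (fun j t hj => by
      have : j ≠ i := by rintro rfl; simp [hi] at hj
      simp [this, hj])
    simp at this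
  · have := h (fun j => (τ j).getD false) (fun j t hj => by simp [hj])
    simpa [hi] using this

end PartialSigns

theorem Set.ssubset_of_mem {α : Type*} {A B : Set α} (h : A ⊆ B) {v : α} (hB : v ∈ B) (hA : v ∉ A) :
    A ⊂ B := ⟨h, fun h' => hA (h' hB)⟩

/-! ### Classification of the faces of a split wedge, and their ranks. -/

namespace WedgeFace

variable {n : ℕ} {k : Fin (n + 2)}

theorem isExtent_extent (φ : WedgeFace n) : Order.IsExtent (WedgeInc k) (φ.extent k) := by
  have hτ := fun (τ : Fin (n + 2) → Option Bool) (i s) => forall_extension_iff τ i s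
  rcases φ with τ | τ | τ | _ | _ | b | _
  · refine ⟨{j | match j with
      | .base => True
      | .roof _ => False
      | .side σ => ∀ i s, τ i = some s → σ i = s}, ?_⟩
    ext v
    simp only [mem_lowerPolar_iff, extent, mem_ofPred_eq]
    rw [← hτ]
    constructor
    · exact fun h => ⟨fun σ hσ => h (b := .side σ) hσ, h (b := .base) trivial⟩
    · rintro ⟨h1, h2⟩ (_ | b | σ) hj
      exacts [h2, hj.elim, h1 σ hj]
  · refine ⟨{j | match j with
      | .base => False
      | .roof b => ∀ s, τ k = some s → s = b
      | .side σ => ∀ i s, τ i = some s → σ i = s}, ?_⟩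
    ext v
    simp only [mem_lowerPolar_iff, extent, mem_ofPred_eq]
    rw [← hτ]
    constructor
    · intro h
      refine ⟨fun σ hσ => h (b := .side σ) hσ, ?_⟩
      -- Some half of the roof always contains the simplex; if `τ k` is `none` both do, and the
      -- default picks one.
      exact (h (b := .roof ((τ k).getD false)) (fun s hs => by simp [hs])).1
    · rintro ⟨h1, h2⟩ (_ | b | σ) hj
      · exact hj.elim
      · refine ⟨h2, fun hk => hj _ ?_⟩
        rw [← hk]
        exact (hτ τ _ _).1 h1
      · exact h1 σ hj
  · refine ⟨{j | match j with
      | .base => False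
      | .roof _ => False
      | .side σ => ∀ i s, τ i = some s → σ i = s}, ?_⟩
    ext v
    simp only [mem_lowerPolar_iff, extent, mem_ofPred_eq]
    rw [← hτ]
    constructor
    · exact fun h σ hσ => h (b := .side σ) hσ
    · rintro h1 (_ | b | σ) hj
      exacts [hj.elim, hj.elim, h1 σ hj]
  · exact ⟨{.base}, by ext v; simp [WedgeInc, extent, mem_lowerPolar_iff]⟩
  · refine ⟨{.roof true, .roof false}, ?_⟩
    ext v
    simp only [mem_lowerPolar_iff, extent, mem_ofPred_eq, mem_insert_iff, mem_singleton_iff,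
      forall_eq_or_imp, forall_eq, WedgeInc]
    cases v.1.2 <;> simp
    tauto
  · exact ⟨{.roof b}, by ext v; simp [WedgeInc, extent, mem_lowerPolar_iff]⟩
  · exact ⟨∅, by simp [extent]⟩

/-- A wall over the apex or over the empty simplex has no height, so it coincides with its bottom.
-/
theorem exists_isValid_side (τ : Fin (n + 2) → Option Bool) :
    ∃ φ : WedgeFace n, φ.IsValid ∧ φ.extent k = (side τ).extent k := by
  by_cases h : ∃ i s, τ i = some s ∧ (i, s) ≠ (0, true)
  · exact ⟨side τ, h, rfl⟩
  · refine ⟨bot τ, trivial, ?_⟩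
    ext v
    push Not at h
    simp only [extent, mem_ofPred_eq, and_iff_left_iff_imp]
    exact fun hv => Or.inr (h _ _ hv)

/-- Every extent is the extent of one of the listed faces. -/
theorem exists_extent_eq {A : Set (WedgePoint n)} (hA : Order.IsExtent (WedgeInc k) A) :
    ∃ φ : WedgeFace n, φ.IsValid ∧ φ.extent k = A := by
  classical
  obtain ⟨I, rfl⟩ := hA
  have hmem : ∀ v, v ∈ lowerPolar (WedgeInc k) I ↔
      (.base ∈ I → v.2 = false ∨ v.1 = (0, true)) ∧
      (∀ b, .roof b ∈ I → (v.2 = true ∨ v.1 = (0, true)) ∧ (v.1.1 = k → v.1.2 = b)) ∧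
      ∀ σ, .side σ ∈ I → σ v.1.1 = v.1.2 := by
    intro v
    rw [mem_lowerPolar_iff]
    constructor
    · exact fun h => ⟨fun hj => h hj, fun b hj => h hj, fun σ hj => h hj⟩
    · rintro ⟨h1, h2, h3⟩ (_ | b | σ) hj
      exacts [h1 hj, h2 b hj, h3 σ hj]
  -- the face is a simplex once its points are cut out by a partial sign vector
  have hsimplex : ∀ τ : Fin (n + 2) → Option Bool, ∀ B R : Prop,
      (∀ v, v ∈ lowerPolar (WedgeInc k) I ↔ τ v.1.1 = some v.1.2 ∧
        (B → v.2 = false ∨ v.1 = (0, true)) ∧ (R → v.2 = true ∨ v.1 = (0, true))) →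
      ∃ φ : WedgeFace n, φ.IsValid ∧ φ.extent k = lowerPolar (WedgeInc k) I := by
    intro τ B R h
    by_cases hB : B <;> by_cases hR : R
    -- Only the apex lies on both base and roof, so at most that vertex survives.
    · refine ⟨bot (fun i => if i = 0 ∧ τ i = some true then some true else none), trivial, ?_⟩
      ext ⟨⟨i, s⟩, u⟩
      simp only [h, hB, hR, extent, mem_ofPred_eq, true_imp_iff, Prod.mk.injEq]
      by_cases hi : i = 0
      · subst hi; cases s <;> cases u <;> simp
      · simp [hi]
    · exact ⟨bot τ, trivial, by ext v; simp [h, hB, hR, extent]⟩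
    · exact ⟨top τ, trivial, by ext v; simp [h, hB, hR, extent]⟩
    · obtain ⟨φ, h1, h2⟩ := exists_isValid_side (k := k) τ
      exact ⟨φ, h1, by rw [h2]; ext v; simp [h, hB, hR, extent]⟩
  by_cases hσ : ∃ σ, .side σ ∈ I
  · obtain ⟨σ, hσ⟩ := hσ
    -- Keep the sign at `i` only where all chosen sides agree and, at `k`, where it matches every
    -- chosen half of the roof.
    refine hsimplex (fun i => if (∀ ρ, .side ρ ∈ I → ρ i = σ i) ∧
      (i = k → ∀ b, .roof b ∈ I → b = σ i) then some (σ i) else none)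
      (.base ∈ I) (∃ b, .roof b ∈ I) fun v => ?_
    rw [hmem]
    constructor
    · rintro ⟨h1, h2, h3⟩
      have hv := h3 σ hσ
      refine ⟨?_, h1, fun ⟨b, hb⟩ => (h2 b hb).1⟩
      rw [if_pos, hv]
      exact ⟨fun ρ hρ => (h3 ρ hρ).trans hv.symm, fun hk b hb => by rw [hv, (h2 b hb).2 hk]⟩
    · rintro ⟨h1, h2, h3⟩
      split_ifs at h1 with hc
      have hv : σ v.1.1 = v.1.2 := by simpa using h1
      exact ⟨h2, fun b hb => ⟨h3 ⟨b, hb⟩, fun hk => by rw [hc.2 hk b hb, hv]⟩,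
        fun ρ hρ => (hc.1 ρ hρ).trans hv⟩
  · have hmem' : ∀ v, v ∈ lowerPolar (WedgeInc k) I ↔
      (.base ∈ I → v.2 = false ∨ v.1 = (0, true)) ∧
      (∀ b, .roof b ∈ I → (v.2 = true ∨ v.1 = (0, true)) ∧ (v.1.1 = k → v.1.2 = b)) := by
      intro v
      rw [hmem]
      push Not at hσ
      simp [hσ]
    by_cases hB : .base ∈ I
    · by_cases hR : ∃ b, .roof b ∈ I
      · obtain ⟨b, hb⟩ := hR
        refine hsimplex (fun i => if i = 0 ∧ ∀ b, .roof b ∈ I → i = k → b = true then some true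
          else none) True True fun ⟨⟨i, s⟩, u⟩ => ?_
        rw [hmem']
        simp only [hB, true_imp_iff, Prod.mk.injEq]
        constructor
        · rintro ⟨h1, h2⟩
          have h3 := (h2 b hb).1
          have h4 : i = 0 ∧ s = true := by
            cases u <;> simpa using And.intro h1 h3
          obtain ⟨rfl, rfl⟩ := h4
          refine ⟨?_, h1, h3⟩
          rw [if_pos ⟨rfl, fun b hb hk => ((h2 b hb).2 hk).symm⟩]
        · rintro ⟨h1, h2, h3⟩
          split_ifs at h1 with hc
          have hs : true = s := by simpa using h1
          subst hs
          exact ⟨h2, fun b hb => ⟨h3, fun hk => (hc.2 b hb hk).symm⟩⟩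
      · refine ⟨base, trivial, ?_⟩
        ext v
        push Not at hR
        simp [hmem', hB, hR, extent]
    · by_cases h1 : .roof true ∈ I <;> by_cases h0 : .roof false ∈ I
      · refine ⟨ridge, trivial, ?_⟩
        ext ⟨⟨i, s⟩, u⟩
        simp only [hmem', hB, Bool.forall_bool, h1, h0, extent, mem_ofPred_eq, false_imp_iff,
          true_imp_iff, true_and]
        cases s <;> simp
        tauto
      · exact ⟨roof true, trivial, by ext v; simp [hmem', hB, h1, h0, extent, Bool.forall_bool]⟩
      · exact ⟨roof false, trivial, by ext v; simp [hmem', hB, h1, h0, extent, Bool.forall_bool]⟩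
      · exact ⟨whole, trivial, by ext v; simp [hmem', hB, h1, h0, extent, Bool.forall_bool]⟩

theorem rank_le (φ : WedgeFace n) (hφ : φ.IsValid) : φ.rank ≤ n + 4 := by
  have h : ∀ τ : Fin (n + 2) → Option Bool, supportCard τ ≤ n + 2 := fun τ => by
    simpa [supportCard] using Finset.card_filter_le (Finset.univ : Finset (Fin (n + 2)))
      fun i => (τ i).isSome
  rcases φ with τ | τ | τ | _ | _ | b | _ <;> simp only [rank] <;> first | omega | skip
  all_goals have := h τ; omega

/-- With `exists_covering`, this puts every face in a chain from rank `0` to the whole wedge whose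
ranks grow by one. -/
theorem exists_covered (φ : WedgeFace n) (hφ : φ.IsValid) (h0 : φ.rank ≠ 0) :
    ∃ ψ : WedgeFace n, ψ.IsValid ∧ ψ.rank + 1 = φ.rank ∧ ψ.extent k ⊂ φ.extent k := by
  have hupd : ∀ (τ : Fin (n + 2) → Option Bool) (i j : Fin (n + 2)) (s : Bool),
      Function.update τ i none j = some s → τ j = some s := by
    intro τ i j s h
    by_cases hj : j = i
    · subst hj; simp at h
    · simpa [hj] using h
  rcases φ with τ | τ | τ | _ | _ | b | _
  · obtain ⟨i, s, hi⟩ := exists_some_of_supportCard_ne_zero h0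
    refine ⟨bot (Function.update τ i none), trivial, supportCard_update_none hi, ?_⟩
    exact ssubset_of_mem (v := ((i, s), false)) (fun v hv => ⟨hupd _ _ _ _ hv.1, hv.2⟩)
      (by simp [extent, hi]) (by simp [extent])
  · obtain ⟨i, s, hi⟩ := exists_some_of_supportCard_ne_zero h0
    refine ⟨top (Function.update τ i none), trivial, supportCard_update_none hi, ?_⟩
    exact ssubset_of_mem (v := ((i, s), true)) (fun v hv => ⟨hupd _ _ _ _ hv.1, hv.2⟩)
      (by simp [extent, hi]) (by simp [extent])
  · obtain ⟨i, s, hi, hne⟩ := hφ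
    refine ⟨bot τ, trivial, rfl, ssubset_of_mem (v := ((i, s), true)) (fun v hv => hv.1) hi ?_⟩
    simpa [extent] using fun _ => by simpa using hne
  · refine ⟨bot fun i => some false, trivial, ?_, ?_⟩
    · simp [rank, supportCard_some]
    · exact ssubset_of_mem (v := ((0, true), false)) (fun v hv => hv.2) (by simp [extent])
        (by simp [extent])
  · obtain ⟨i, hi⟩ := exists_ne k
    refine ⟨top (Function.update (fun i => some false) k none), trivial, ?_, ?_⟩
    · simp only [rank]
      rw [supportCard_update_none (s := false) rfl, supportCard_some]
    · refine ssubset_of_mem (v := ((i, true), true)) (fun v hv => ⟨hv.2, fun hk => ?_⟩)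
        (by simp [extent, hi]) (by simp [extent, hi])
      have := hv.1
      simp [hk] at this
  · obtain ⟨i, hi⟩ := exists_ne k
    refine ⟨top fun i => some b, trivial, ?_, ?_⟩
    · simp [rank, supportCard_some]
    · exact ssubset_of_mem (v := ((i, !b), true))
        (fun v hv => ⟨hv.2, fun hk => by simpa using hv.1.symm⟩)
        (by simp [extent, hi]) (by simp [extent])
  · refine ⟨base, trivial, rfl, ?_⟩
    exact ssubset_of_mem (v := ((0, false), true)) (fun v hv => trivial) trivial (by simp [extent])

theorem exists_covering (φ : WedgeFace n) (hφ : φ.IsValid) (h0 : φ.rank ≠ n + 4) :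
    ∃ ψ : WedgeFace n, ψ.IsValid ∧ ψ.rank = φ.rank + 1 ∧ φ.extent k ⊂ ψ.extent k := by
  have hupd : ∀ (τ : Fin (n + 2) → Option Bool) (i j : Fin (n + 2)) (s t : Bool), τ i = none →
      τ j = some s → Function.update τ i (some t) j = some s := by
    intro τ i j s t hi h
    have hj : j ≠ i := by rintro rfl; simp [hi] at h
    simpa [hj] using h
  rcases φ with τ | τ | τ | _ | _ | b | _
  · rcases exists_eq_none_or τ with ⟨i, hi⟩ | ⟨σ, rfl⟩
    · refine ⟨bot (Function.update τ i (some true)), trivial, supportCard_update_some _ hi, ?_⟩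
      exact ssubset_of_mem (v := ((i, true), false)) (fun v hv => ⟨hupd _ _ _ _ _ hi hv.1, hv.2⟩)
        (by simp [extent]) (by simp [extent, hi])
    · refine ⟨base, trivial, by simp [rank, supportCard_some], ?_⟩
      exact ssubset_of_mem (v := ((0, !(σ 0)), false)) (fun v hv => hv.2)
        (by simp [extent]) (by simp [extent])
  · rcases exists_eq_none_or τ with ⟨i, hi⟩ | ⟨σ, rfl⟩
    · refine ⟨top (Function.update τ i (some true)), trivial, supportCard_update_some _ hi, ?_⟩
      exact ssubset_of_mem (v := ((i, true), true)) (fun v hv => ⟨hupd _ _ _ _ _ hi hv.1, hv.2⟩)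
        (by simp [extent]) (by simp [extent, hi])
    -- The sign at coordinate `1`, which differs from `0`, certifies that the wall is not
    -- degenerate.
    · refine ⟨side _, ⟨1, σ 1, rfl, by simp⟩, rfl, ?_⟩
      exact ssubset_of_mem (v := ((1, σ 1), false)) (fun v hv => hv.1)
        (by simp [extent]) (by simp [extent])
  · rcases exists_eq_none_or τ with ⟨i, hi⟩ | ⟨σ, rfl⟩
    · obtain ⟨j, s, hj, hne⟩ := hφ
      refine ⟨side (Function.update τ i (some true)), ⟨j, s, hupd _ _ _ _ _ hi hj, hne⟩, ?_, ?_⟩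
      · simp [rank, supportCard_update_some _ hi]
      · exact ssubset_of_mem (v := ((i, true), true)) (fun v hv => hupd _ _ _ _ _ hi hv)
          (by simp [extent]) (by simp [extent, hi])
    · refine ⟨whole, trivial, by simp [rank, supportCard_some], ?_⟩
      exact ssubset_of_mem (v := ((0, !(σ 0)), false)) (fun v hv => trivial) trivial
        (by simp [extent])
  · refine ⟨whole, trivial, rfl, ?_⟩
    exact ssubset_of_mem (v := ((0, false), true)) (fun v hv => trivial) trivial (by simp [extent])
  · refine ⟨roof true, trivial, rfl, ?_⟩
    exact ssubset_of_mem (v := ((k, true), true)) (fun v hv => ⟨hv.1, fun h => (hv.2 h).elim⟩)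
      (by simp [extent]) (by simp [extent])
  · refine ⟨whole, trivial, rfl, ?_⟩
    exact ssubset_of_mem (v := ((0, false), false)) (fun v hv => trivial) trivial (by simp [extent])
  · exact absurd rfl h0

/-- A function on extents that is strictly monotone with the right values at the ends is the
rank. -/
theorem eq_rank_of_strictMono {f : Set (WedgePoint n) → ℕ}
    (hf : ∀ A B, Order.IsExtent (WedgeInc k) A → Order.IsExtent (WedgeInc k) B → A ⊂ B → f A < f B)
    (htop : f univ ≤ n + 4) (φ : WedgeFace n) (hφ : φ.IsValid) : f (φ.extent k) = φ.rank := by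
  have hlt : ∀ φ ψ : WedgeFace n, φ.extent k ⊂ ψ.extent k → f (φ.extent k) < f (ψ.extent k) :=
    fun φ ψ => hf _ _ φ.isExtent_extent ψ.isExtent_extent
  apply le_antisymm
  -- Climbing to the top takes `n + 4 - φ.rank` strict increases, which bounds `f` above; descending
  -- to rank `0` in the second half bounds it below.
  · obtain ⟨m, hm⟩ : ∃ m, φ.rank + m = n + 4 := ⟨_, Nat.add_sub_of_le (φ.rank_le hφ)⟩
    induction m generalizing φ with
    | zero =>
      have hle : f (φ.extent k) ≤ f univ := by
        rcases (subset_univ (φ.extent k)).eq_or_ssubset with h | h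
        · rw [h]
        · exact (hf _ _ φ.isExtent_extent Order.IsExtent.univ h).le
      omega
    | succ m ih =>
      obtain ⟨ψ, hψ, hr, hs⟩ := φ.exists_covering (k := k) hφ (by omega)
      have := ih ψ hψ (by omega)
      have := hlt _ _ hs
      omega
  · obtain ⟨m, hm⟩ : ∃ m, φ.rank = m := ⟨_, rfl⟩
    induction m generalizing φ with
    | zero => omega
    | succ m ih =>
      obtain ⟨ψ, hψ, hr, hs⟩ := φ.exists_covered (k := k) hφ (by omega)
      have := ih ψ hψ (by omega)
      have := hlt _ _ hs
      omega

end WedgeFace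

/-- `A` is the set of points of a face of dimension `r - 1` of a split wedge. -/
def HasRank {n : ℕ} (k : Fin (n + 2)) (A : Set (WedgePoint n)) (r : ℕ) : Prop :=
  ∃ φ : WedgeFace n, φ.IsValid ∧ φ.extent k = A ∧ φ.rank = r

theorem HasRank.isExtent {n : ℕ} {k : Fin (n + 2)} {A : Set (WedgePoint n)} {r : ℕ}
    (h : HasRank k A r) : Order.IsExtent (WedgeInc k) A := by
  obtain ⟨φ, -, rfl, -⟩ := h
  exact φ.isExtent_extent

noncomputable instance (n : ℕ) : Fintype (WedgeFacet n) :=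
  open Classical in
  Fintype.ofSurjective
    (fun x : Unit ⊕ Bool ⊕ (Fin (n + 2) → Bool) =>
      Sum.elim (fun _ => .base) (Sum.elim .roof .side) x)
    (by
      rintro (_ | b | σ)
      exacts [⟨.inl (), rfl⟩, ⟨.inr (.inl b), rfl⟩, ⟨.inr (.inr σ), rfl⟩])

/-! ### Dimensions of faces, and isomorphisms of the two skeleta. -/

section SkeletonIso

variable {n : ℕ} {k k' : Fin (n + 2)} {p q : WedgePoint n → EuclideanSpace ℝ (Fin (n + 3))}
  {a a' : WedgeFacet n → EuclideanSpace ℝ (Fin (n + 3))} {c c' : WedgeFacet n → ℝ}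

theorem dimSucc_le_succ {d : ℕ} (G : Set (EuclideanSpace ℝ (Fin d))) : dimSucc G ≤ d + 1 := by
  unfold dimSucc
  split_ifs
  · have := (affineSpan ℝ G).direction.finrank_le
    rw [finrank_euclideanSpace_fin] at this
    omega
  · omega

theorem isKFace_iff_hasRank (h : IsDoubleDescription p a c (WedgeInc k)) (m : ℕ)
    (G : Set (EuclideanSpace ℝ (Fin (n + 3)))) :
    IsKFace (convexHull ℝ (range p)) m G ↔
      ∃ A, HasRank k A (m + 1) ∧ G = convexHull ℝ (p '' A) := by
  have hdim : ∀ φ : WedgeFace n, φ.IsValid →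
      dimSucc (convexHull ℝ (p '' φ.extent k)) = φ.rank := by
    intro φ hφ
    refine WedgeFace.eq_rank_of_strictMono (f := fun A => dimSucc (convexHull ℝ (p '' A)))
      (fun A B hA hB hAB => ?_) (dimSucc_le_succ _) φ hφ
    have hpos : 0 < n + 3 := by omega
    refine dimSucc_lt_of_ssubset (h.isFace_convexHull_image hpos hA)
      (h.isFace_convexHull_image hpos hB) ⟨convexHull_mono (image_mono hAB.1), fun hBA => hAB.2 ?_⟩
    rw [← h.preimage_convexHull_image hA, ← h.preimage_convexHull_image hB]
    exact preimage_mono hBA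
  constructor
  · intro hG
    obtain ⟨A, hA, rfl⟩ := (h.isFace_iff (by omega)).1 hG.1
    obtain ⟨φ, hφ, rfl⟩ := WedgeFace.exists_extent_eq hA
    refine ⟨_, ⟨φ, hφ, rfl, ?_⟩, rfl⟩
    rw [← hdim φ hφ]
    exact (isKFace_iff_dimSucc hG.1 m).1 hG
  · rintro ⟨_, ⟨φ, hφ, rfl, hr⟩, rfl⟩
    rw [isKFace_iff_dimSucc (h.isFace_convexHull_image (by omega) φ.isExtent_extent), hdim φ hφ, hr]

/-- Mutually inverse monotone maps on label sets need to be controlled only in the given range of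
ranks. The isomorphism is recorded as preserving dimension, so that graphs can be read off from it.
-/
theorem skeleton_iso_of_monotone (h : IsDoubleDescription p a c (WedgeInc k))
    (h' : IsDoubleDescription q a' c' (WedgeInc k')) {l u : ℕ}
    {f g : Set (WedgePoint n) → Set (WedgePoint n)} (hf : Monotone f) (hg : Monotone g)
    (hfr : ∀ A m, l ≤ m → m ≤ u → HasRank k A (m + 1) → HasRank k' (f A) (m + 1) ∧ g (f A) = A)
    (hgr : ∀ A m, l ≤ m → m ≤ u → HasRank k' A (m + 1) → HasRank k (g A) (m + 1) ∧ f (g A) = A) :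
    ∃ e : Skeleton (convexHull ℝ (range p)) l u ≃o Skeleton (convexHull ℝ (range q)) l u,
      ∀ x m, l ≤ m → m ≤ u → (IsKFace (convexHull ℝ (range p)) m x.1 ↔
        IsKFace (convexHull ℝ (range q)) m (e x).1) := by
  have fwd : ∀ G m, l ≤ m → m ≤ u → IsKFace (convexHull ℝ (range p)) m G →
      IsKFace (convexHull ℝ (range q)) m (convexHull ℝ (q '' f (p ⁻¹' G))) ∧
      convexHull ℝ (p '' g (q ⁻¹' (convexHull ℝ (q '' f (p ⁻¹' G))))) = G := by
    intro G m hl hu hG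
    obtain ⟨A, hA, rfl⟩ := (isKFace_iff_hasRank h m G).1 hG
    obtain ⟨h1, h2⟩ := hfr A m hl hu hA
    rw [h.preimage_convexHull_image hA.isExtent, h'.preimage_convexHull_image h1.isExtent, h2]
    exact ⟨(isKFace_iff_hasRank h' m _).2 ⟨_, h1, rfl⟩, rfl⟩
  have bwd : ∀ G m, l ≤ m → m ≤ u → IsKFace (convexHull ℝ (range q)) m G →
      IsKFace (convexHull ℝ (range p)) m (convexHull ℝ (p '' g (q ⁻¹' G))) ∧
      convexHull ℝ (q '' f (p ⁻¹' (convexHull ℝ (p '' g (q ⁻¹' G))))) = G := by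
    intro G m hl hu hG
    obtain ⟨A, hA, rfl⟩ := (isKFace_iff_hasRank h' m G).1 hG
    obtain ⟨h1, h2⟩ := hgr A m hl hu hA
    rw [h'.preimage_convexHull_image hA.isExtent, h.preimage_convexHull_image h1.isExtent, h2]
    exact ⟨(isKFace_iff_hasRank h m _).2 ⟨_, h1, rfl⟩, rfl⟩
  let e : Skeleton (convexHull ℝ (range p)) l u ≃ Skeleton (convexHull ℝ (range q)) l u :=
    { toFun := fun x => ⟨convexHull ℝ (q '' f (p ⁻¹' x.1)), by
        obtain ⟨m, hl, hu, hm⟩ := x.2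
        exact ⟨m, hl, hu, (fwd _ m hl hu hm).1⟩⟩
      invFun := fun x => ⟨convexHull ℝ (p '' g (q ⁻¹' x.1)), by
        obtain ⟨m, hl, hu, hm⟩ := x.2
        exact ⟨m, hl, hu, (bwd _ m hl hu hm).1⟩⟩
      left_inv := fun x => by
        obtain ⟨m, hl, hu, hm⟩ := x.2
        exact Subtype.ext (fwd _ m hl hu hm).2
      right_inv := fun x => by
        obtain ⟨m, hl, hu, hm⟩ := x.2
        exact Subtype.ext (bwd _ m hl hu hm).2 }
  refine ⟨e.toOrderIso (fun x y hxy => ?_) (fun x y hxy => ?_), fun x m hl hu => ⟨fun hm => ?_,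
    fun hm => ?_⟩⟩
  · exact convexHull_mono (image_mono (hf (preimage_mono hxy)))
  · exact convexHull_mono (image_mono (hg (preimage_mono hxy)))
  · exact (fwd _ m hl hu hm).1
  · have := (bwd _ m hl hu hm).1
    exact (congrArg Subtype.val (e.left_inv x)) ▸ this

/-- Faces of small dimension do not see along which coordinate the roof is split. -/
theorem HasRank.congr_of_le {A : Set (WedgePoint n)} {r : ℕ} (hr : r ≤ n + 1)
    (h : HasRank k A r) : HasRank k' A r := by
  obtain ⟨φ, hφ, rfl, hφr⟩ := h
  refine ⟨φ, hφ, ?_, hφr⟩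
  -- Only simplices and walls have rank at most `n + 1`, and their extents do not involve `k`; the
  -- ridge already has rank `n + 2`.
  rcases φ with τ | τ | τ | _ | _ | b | _ <;> first | rfl | (simp only [WedgeFace.rank] at hφr; omega)

theorem exists_skeleton_iso_low (h : IsDoubleDescription p a c (WedgeInc k))
    (h' : IsDoubleDescription q a' c' (WedgeInc k')) :
    ∃ e : Skeleton (convexHull ℝ (range p)) 0 n ≃o Skeleton (convexHull ℝ (range q)) 0 n,
      ∀ x m, 0 ≤ m → m ≤ n → (IsKFace (convexHull ℝ (range p)) m x.1 ↔
        IsKFace (convexHull ℝ (range q)) m (e x).1) :=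
  skeleton_iso_of_monotone h h' (f := id) (g := id) monotone_id monotone_id
    (fun _ _ _ hu hA => ⟨hA.congr_of_le (by omega), rfl⟩)
    (fun _ _ _ hu hA => ⟨hA.congr_of_le (by omega), rfl⟩)

/-- The action of a permutation of the coordinates on facets. -/
def WedgeFacet.perm (e : Equiv.Perm (Fin (n + 2))) : WedgeFacet n → WedgeFacet n
  | .base => .base
  | .roof b => .roof b
  | .side σ => .side (σ ∘ e)

/-- The action of a permutation of the coordinates on combinatorial types of faces. -/
def WedgeFace.perm (e : Equiv.Perm (Fin (n + 2))) : WedgeFace n → WedgeFace n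
  | .bot τ => .bot (τ ∘ e)
  | .top τ => .top (τ ∘ e)
  | .side τ => .side (τ ∘ e)
  | .base => .base
  | .ridge => .ridge
  | .roof b => .roof b
  | .whole => .whole

theorem WedgeFace.rank_perm (e : Equiv.Perm (Fin (n + 2))) (φ : WedgeFace n) :
    (φ.perm e).rank = φ.rank := by
  rcases φ with τ | τ | τ | _ | _ | b | _ <;> simp [WedgeFace.perm, WedgeFace.rank, supportCard_comp]

/-- A wall of rank at least `3` stands over at least two vertices, so no permutation collapses it
onto the apex. A vertical edge, of rank `2`, could be moved there. -/
theorem WedgeFace.isValid_perm (e : Equiv.Perm (Fin (n + 2))) {φ : WedgeFace n}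
    (hr : 3 ≤ φ.rank) (hφ : φ.IsValid) : (φ.perm e).IsValid := by
  rcases φ with τ | τ | τ | _ | _ | b | _ <;> try exact trivial
  obtain ⟨i, s, hi, hs⟩ := exists_ne_of_two_le_supportCard (τ := τ ∘ e)
    (by rw [supportCard_comp]; simpa [WedgeFace.rank] using hr) 0
  exact ⟨i, s, hs, by simp [hi]⟩

theorem WedgeFace.perm_perm_symm (e : Equiv.Perm (Fin (n + 2))) (φ : WedgeFace n) :
    (φ.perm e).perm e.symm = φ := by
  rcases φ with τ | τ | τ | _ | _ | b | _ <;> simp [WedgeFace.perm, Function.comp_assoc]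

theorem WedgeFace.lowerPolar_upperPolar_extent (φ : WedgeFace n) :
    lowerPolar (WedgeInc k) (upperPolar (WedgeInc k) (φ.extent k)) = φ.extent k :=
  Order.isExtent_iff.1 φ.isExtent_extent

/-- The facets containing a face of dimension at least two. -/
def WedgeFace.IsIn (k : Fin (n + 2)) : WedgeFace n → WedgeFacet n → Prop
  | bot _, .base => True
  | bot _, .roof _ => False
  | bot τ, .side σ => ∀ i s, τ i = some s → σ i = s
  | top _, .base => False
  | top τ, .roof b => ∀ s, τ k = some s → s = b
  | top τ, .side σ => ∀ i s, τ i = some s → σ i = s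
  | side _, .base => False
  | side _, .roof _ => False
  | side τ, .side σ => ∀ i s, τ i = some s → σ i = s
  | base, j => j = .base
  | ridge, j => ∃ b, j = .roof b
  | roof b, j => j = .roof b
  | whole, _ => False

/-- A simplex or wall of rank at least `3` has a vertex off coordinate `0`, so containment in the
base or roof is never due to the apex alone. Hence `IsIn` does not mention the apex and is symmetric
under permutations of coordinates. -/
theorem WedgeFace.mem_upperPolar_extent_iff {φ : WedgeFace n} (hr : 3 ≤ φ.rank)
    (j : WedgeFacet n) : j ∈ upperPolar (WedgeInc k) (φ.extent k) ↔ φ.IsIn k j := by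
  rw [mem_upperPolar_iff]
  obtain ⟨i₀, hi₀⟩ := exists_ne k
  rcases φ with τ | τ | τ | _ | _ | b | _ <;> rcases j with _ | b' | σ <;>
    simp only [WedgeFace.rank] at hr <;> simp only [IsIn]
  · exact iff_true_intro fun v hv => hv.2
  · obtain ⟨i, s, hi, hs⟩ := exists_ne_of_two_le_supportCard (by omega : 2 ≤ supportCard τ) 0
    exact iff_false_intro fun h => by
      simpa [WedgeInc, hi] using (h (a := ((i, s), false)) ⟨hs, Or.inl rfl⟩).1
  · exact ⟨fun h i s hi => h (a := ((i, s), false)) ⟨hi, Or.inl rfl⟩,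
      fun h v hv => h _ _ hv.1⟩
  · obtain ⟨i, s, hi, hs⟩ := exists_ne_of_two_le_supportCard (by omega : 2 ≤ supportCard τ) 0
    exact iff_false_intro fun h => by
      simpa [WedgeInc, hi] using h (a := ((i, s), true)) ⟨hs, Or.inl rfl⟩
  · exact ⟨fun h s hs => (h (a := ((k, s), true)) ⟨hs, Or.inl rfl⟩).2 rfl,
      fun h v hv => ⟨hv.2, fun hk => h _ (hk ▸ hv.1)⟩⟩
  · exact ⟨fun h i s hi => h (a := ((i, s), true)) ⟨hi, Or.inl rfl⟩,
      fun h v hv => h _ _ hv.1⟩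
  · obtain ⟨i, s, hi, hs⟩ := exists_ne_of_two_le_supportCard (by omega : 2 ≤ supportCard τ) 0
    exact iff_false_intro fun h => by
      simpa [WedgeInc, hi] using h (a := ((i, s), true)) hs
  · obtain ⟨i, s, hi, hs⟩ := exists_ne_of_two_le_supportCard (by omega : 2 ≤ supportCard τ) 0
    exact iff_false_intro fun h => by
      simpa [WedgeInc, hi] using (h (a := ((i, s), false)) hs).1
  · exact ⟨fun h i s hi => h (a := ((i, s), true)) hi, fun h v hv => h _ _ hv⟩
  · exact iff_true_intro fun v hv => hv
  · exact iff_of_false (fun h => by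
      simpa [WedgeInc] using (h (a := ((0, false), false)) (Or.inl rfl)).1) (by simp)
  · exact iff_of_false (fun h => by
      simpa [WedgeInc] using h (a := ((0, !(σ 0)), false)) (Or.inl rfl)) (by simp)
  · exact iff_of_false (fun h => by
      simpa [WedgeInc] using h (a := ((i₀, false), true)) ⟨Or.inl rfl, hi₀⟩) (by simp)
  · exact iff_of_true (fun v hv => ⟨hv.1, fun hk => (hv.2 hk).elim⟩) ⟨_, rfl⟩
  · exact iff_of_false (fun h => by
      simpa [WedgeInc] using h (a := ((i₀, !(σ i₀)), true)) ⟨Or.inl rfl, hi₀⟩) (by simp)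
  · exact iff_of_false (fun h => by
      simpa [WedgeInc] using h (a := ((i₀, false), true)) ⟨Or.inl rfl, fun hk => (hi₀ hk).elim⟩)
      (by simp)
  · refine ⟨fun h => ?_, fun h => ?_⟩
    · exact congrArg _ ((h (a := ((k, b), true)) ⟨Or.inl rfl, fun _ => rfl⟩).2 rfl).symm
    · obtain rfl : b' = b := by simpa using h
      exact fun v hv => hv
  · exact iff_of_false (fun h => by
      simpa [WedgeInc] using
        h (a := ((i₀, !(σ i₀)), true)) ⟨Or.inl rfl, fun hk => (hi₀ hk).elim⟩) (by simp)
  · exact iff_false_intro fun h => by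
      simpa [WedgeInc] using h (a := ((0, false), true)) trivial
  · exact iff_false_intro fun h => by
      simpa [WedgeInc] using (h (a := ((0, false), false)) trivial).1
  · exact iff_false_intro fun h => by
      simpa [WedgeInc] using h (a := ((0, !(σ 0)), false)) trivial

theorem WedgeFacet.perm_symm_perm (e : Equiv.Perm (Fin (n + 2))) (j : WedgeFacet n) :
    (j.perm e.symm).perm e = j := by
  rcases j with _ | b | σ <;> simp [WedgeFacet.perm, Function.comp_assoc]

/-- Permuting coordinates preserves incidences between faces of dimension at least two and
facets, when the coordinate splitting the roof is permuted as well. -/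
theorem WedgeFace.upperPolar_extent_perm (e : Equiv.Perm (Fin (n + 2))) {φ : WedgeFace n}
    (hr : 3 ≤ φ.rank) :
    upperPolar (WedgeInc (e.symm k)) ((φ.perm e).extent (e.symm k)) =
      WedgeFacet.perm e.symm ⁻¹' upperPolar (WedgeInc k) (φ.extent k) := by
  ext j
  obtain ⟨j, rfl⟩ : ∃ i : WedgeFacet n, i.perm e = j := ⟨_, j.perm_symm_perm e⟩
  have hj : (j.perm e).perm e.symm = j := j.perm_symm_perm e.symm
  rw [mem_preimage, hj, mem_upperPolar_extent_iff (by rwa [rank_perm]),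
    mem_upperPolar_extent_iff hr]
  have hside : ∀ (τ : Fin (n + 2) → Option Bool) (σ : Fin (n + 2) → Bool),
      (∀ i s, τ (e i) = some s → σ (e i) = s) ↔ ∀ i s, τ i = some s → σ i = s :=
    fun τ σ => e.forall_congr_left.trans (by simp)
  rcases φ with τ | τ | τ | _ | _ | b | _ <;> rcases j with _ | b' | σ <;>
    simp only [IsIn, WedgeFace.perm, WedgeFacet.perm, Function.comp_apply, e.apply_symm_apply,
      reduceCtorEq, exists_const, hside, WedgeFacet.roof.injEq]

/-- The map on sets of points induced by a permutation of the coordinates, through the facets. -/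
def dualPerm (k : Fin (n + 2)) (e : Equiv.Perm (Fin (n + 2))) (A : Set (WedgePoint n)) :
    Set (WedgePoint n) :=
  lowerPolar (WedgeInc (e.symm k)) (WedgeFacet.perm e.symm ⁻¹' upperPolar (WedgeInc k) A)

/-- Permuting labels of points would misplace the apex, but facets can be permuted freely. Taking
polars before and after turns this into the expected action on faces of rank at least `3`, and into
a map monotone on all label sets. -/
theorem dualPerm_extent (e : Equiv.Perm (Fin (n + 2))) {φ : WedgeFace n} (hr : 3 ≤ φ.rank) :
    dualPerm k e (φ.extent k) = (φ.perm e).extent (e.symm k) := by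
  rw [dualPerm, ← WedgeFace.upperPolar_extent_perm e hr, WedgeFace.lowerPolar_upperPolar_extent]

theorem monotone_dualPerm (e : Equiv.Perm (Fin (n + 2))) : Monotone (dualPerm k e) :=
  fun _ _ h => lowerPolar_anti _ (preimage_mono (upperPolar_anti _ h))

theorem HasRank.dualPerm_symm {A : Set (WedgePoint n)} {r : ℕ} (e : Equiv.Perm (Fin (n + 2)))
    (hr : 3 ≤ r) (h : HasRank k A r) : HasRank (e.symm k) (dualPerm k e A) r ∧
      dualPerm (e.symm k) e.symm (dualPerm k e A) = A := by
  obtain ⟨φ, hφ, rfl, rfl⟩ := h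
  rw [dualPerm_extent e hr, dualPerm_extent e.symm (by rwa [WedgeFace.rank_perm]),
    WedgeFace.perm_perm_symm, e.symm_symm, e.apply_symm_apply]
  exact ⟨⟨_, WedgeFace.isValid_perm e hr hφ, rfl, WedgeFace.rank_perm e φ⟩, rfl⟩

theorem exists_skeleton_iso_high (h : IsDoubleDescription p a c (WedgeInc k))
    (h' : IsDoubleDescription q a' c' (WedgeInc k')) :
    ∃ e : Skeleton (convexHull ℝ (range p)) 2 (n + 2) ≃o
        Skeleton (convexHull ℝ (range q)) 2 (n + 2),
      ∀ x m, 2 ≤ m → m ≤ n + 2 → (IsKFace (convexHull ℝ (range p)) m x.1 ↔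
        IsKFace (convexHull ℝ (range q)) m (e x).1) := by
  let e : Equiv.Perm (Fin (n + 2)) := Equiv.swap k k'
  have hk' : k' = e.symm k := by simp [e]
  have hk : k = e.symm k' := by simp [e]
  have he : e.symm = e := Equiv.symm_swap k k'
  refine skeleton_iso_of_monotone h h' (monotone_dualPerm (k := k) e)
    (monotone_dualPerm (k := k') e) (fun A m hl _ hA => ?_) (fun A m hl _ hA => ?_)
  · have := hA.dualPerm_symm e (by omega)
    rwa [← hk', he] at this
  · have := hA.dualPerm_symm e (by omega)
    rwa [← hk, he] at this

end SkeletonIso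

/-! ### An invariant that separates the face lattices. -/

section NotIso

/-- Some two coatoms both meet every coatom. -/
def HasTwoMeetingCoatoms (L : Type*) [Lattice L] [BoundedOrder L] : Prop :=
  ∃ x y : L, x ≠ y ∧ IsCoatom x ∧ IsCoatom y ∧
    ∀ z, IsCoatom z → ¬ Disjoint x z ∧ ¬ Disjoint y z

theorem HasTwoMeetingCoatoms.of_orderIso {L L' : Type*} [Lattice L] [BoundedOrder L] [Lattice L']
    [BoundedOrder L'] (e : L ≃o L') (h : HasTwoMeetingCoatoms L) : HasTwoMeetingCoatoms L' := by
  obtain ⟨x, y, hne, hx, hy, hz⟩ := h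
  refine ⟨e x, e y, e.injective.ne hne, (e.isCoatom_iff x).2 hx, (e.isCoatom_iff y).2 hy,
    fun z hzc => ?_⟩
  have := hz (e.symm z) ((e.symm.isCoatom_iff z).2 hzc)
  rwa [← disjoint_map_orderIso_iff e, ← disjoint_map_orderIso_iff e, e.apply_symm_apply] at this

variable {n : ℕ} {k : Fin (n + 2)}

theorem lowerPolar_singleton_ne_univ (j : WedgeFacet n) :
    lowerPolar (WedgeInc k) {j} ≠ univ := by
  intro h
  have hm : ∀ v, WedgeInc k v j := fun v => (mem_lowerPolar_singleton _).1 (h ▸ mem_univ v)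
  rcases j with _ | b | σ
  · simpa [WedgeInc] using hm ((0, false), true)
  · simpa [WedgeInc] using (hm ((0, false), false)).1
  · simpa [WedgeInc] using hm ((0, !(σ 0)), false)

/-- No facet contains another one. -/
theorem eq_of_forall_wedgeInc {j j' : WedgeFacet n}
    (h : ∀ v, WedgeInc k v j → WedgeInc k v j') : j = j' := by
  obtain ⟨i, hi⟩ := exists_ne k
  rcases j with _ | b | σ <;> rcases j' with _ | b' | σ'
  · rfl
  · simpa [WedgeInc] using (h ((0, false), false) (Or.inl rfl)).1
  · simpa [WedgeInc] using h ((0, !(σ' 0)), false) (Or.inl rfl)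
  · simpa [WedgeInc] using h ((i, false), true) ⟨Or.inl rfl, fun hk => (hi hk).elim⟩
  · exact congrArg _ ((h ((k, b), true) ⟨Or.inl rfl, fun _ => rfl⟩).2 rfl)
  · simpa [WedgeInc] using h ((i, !(σ' i)), true) ⟨Or.inl rfl, fun hk => (hi hk).elim⟩
  · simpa [WedgeInc] using h ((1, σ 1), true) rfl
  · simpa [WedgeInc] using (h ((1, σ 1), false) rfl).1
  · congr 1
    exact funext fun i => (h ((i, σ i), true) rfl).symm

/-- Every proper extent lies in the point set of a single facet, and these point sets are proper and
form an antichain. -/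
theorem isCoatom_iff_exists_facet (x : Concept (WedgePoint n) (WedgeFacet n) (WedgeInc k)) :
    IsCoatom x ↔ ∃ j, x.extent = lowerPolar (WedgeInc k) {j} := by
  have hle : ∀ x : Concept (WedgePoint n) (WedgeFacet n) (WedgeInc k), x ≠ ⊤ →
      ∃ j, x.extent ⊆ lowerPolar (WedgeInc k) {j} := by
    intro x hx
    obtain ⟨I, hI⟩ := x.isExtent_extent
    rcases I.eq_empty_or_nonempty with rfl | ⟨j, hj⟩
    · exact absurd (Concept.ext (by rw [← hI]; simp)) hx
    · exact ⟨j, hI ▸ lowerPolar_anti _ (singleton_subset_iff.2 hj)⟩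
  constructor
  · intro hx
    obtain ⟨j, hj⟩ := hle x hx.1
    refine ⟨j, ?_⟩
    let y := Concept.ofIsExtent (WedgeInc k) _ (Order.isExtent_lowerPolar (t := {j}))
    have hy : y ≠ ⊤ := fun h => lowerPolar_singleton_ne_univ (k := k) j
      (congrArg Concept.extent h)
    have hxy : x ≤ y := hj
    have := (hx.le_iff_eq hy).1 hxy
    exact (congrArg Concept.extent this).symm
  · rintro ⟨j, hj⟩
    refine ⟨fun h => lowerPolar_singleton_ne_univ (k := k) j (by rw [← hj, h]; rfl),
      fun y hxy => ?_⟩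
    by_contra hy
    obtain ⟨j', hj'⟩ := hle y hy
    have hsub : x.extent ⊆ y.extent := hxy.le
    obtain rfl : j = j' := eq_of_forall_wedgeInc (k := k) fun v hv =>
      (mem_lowerPolar_singleton _).1 (hj' (hsub (hj ▸ (mem_lowerPolar_singleton _).2 hv)))
    exact hxy.not_ge (show y.extent ⊆ x.extent from hj ▸ hj')

theorem disjoint_iff_forall_not_wedgeInc
    {x y : Concept (WedgePoint n) (WedgeFacet n) (WedgeInc k)} {j j' : WedgeFacet n}
    (hx : x.extent = lowerPolar (WedgeInc k) {j}) (hy : y.extent = lowerPolar (WedgeInc k) {j'}) :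
    Disjoint x y ↔ ∀ v, ¬ (WedgeInc k v j ∧ WedgeInc k v j') := by
  have hbot : (⊥ : Concept (WedgePoint n) (WedgeFacet n) (WedgeInc k)).extent = ∅ := by
    refine eq_empty_of_forall_notMem fun v hv => ?_
    have hv' : v ∈ lowerPolar (WedgeInc k) univ := hv
    have h := hv' (mem_univ (.side fun _ => !v.1.2))
    simp [WedgeInc] at h
  rw [disjoint_iff]
  constructor
  · intro h v hv
    have : v ∈ (x ⊓ y).extent := by
      change v ∈ x.extent ∩ y.extent
      rw [hx, hy]
      exact ⟨(mem_lowerPolar_singleton _).2 hv.1, (mem_lowerPolar_singleton _).2 hv.2⟩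
    rw [h, hbot] at this
    exact this
  · intro h
    refine Concept.ext ?_
    rw [hbot]
    refine eq_empty_of_forall_notMem fun v hv => ?_
    change v ∈ x.extent ∩ y.extent at hv
    rw [hx, hy] at hv
    exact h v ⟨(mem_lowerPolar_singleton _).1 hv.1, (mem_lowerPolar_singleton _).1 hv.2⟩

/-- When `k ≠ 0` the apex is on the crease, hence on the base and on both halves of the roof. A side
meets the base and a half of the roof in its points over coordinate `0`, where the split imposes no
condition. -/
theorem hasTwoMeetingCoatoms_of_ne_zero (hk : k ≠ 0) :
    HasTwoMeetingCoatoms (Concept (WedgePoint n) (WedgeFacet n) (WedgeInc k)) := by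
  let f : WedgeFacet n → Concept (WedgePoint n) (WedgeFacet n) (WedgeInc k) := fun j =>
    Concept.ofIsExtent (WedgeInc k) _ (Order.isExtent_lowerPolar (t := {j}))
  have hf : ∀ j, (f j).extent = lowerPolar (WedgeInc k) {j} := fun j => rfl
  have hk' : (0 : Fin (n + 2)) ≠ k := hk.symm
  refine ⟨f .base, f (.roof true), fun h => ?_, (isCoatom_iff_exists_facet _).2 ⟨_, hf _⟩,
    (isCoatom_iff_exists_facet _).2 ⟨_, hf _⟩, fun z hz => ?_⟩
  · have h' : lowerPolar (WedgeInc k) {.base} = lowerPolar (WedgeInc k) {.roof true} :=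
      congrArg Concept.extent h
    have : (WedgeFacet.base : WedgeFacet n) = .roof true :=
      eq_of_forall_wedgeInc (k := k) fun v hv =>
        (mem_lowerPolar_singleton _).1 (h' ▸ (mem_lowerPolar_singleton _).2 hv)
    cases this
  · obtain ⟨j, hj⟩ := (isCoatom_iff_exists_facet _).1 hz
    rw [disjoint_iff_forall_not_wedgeInc (hf _) hj, disjoint_iff_forall_not_wedgeInc (hf _) hj]
    push Not
    rcases j with _ | b | σ
    · exact ⟨⟨((0, true), true), by simp [WedgeInc]⟩, ⟨((0, true), true), by simp [WedgeInc, hk']⟩⟩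
    · exact ⟨⟨((0, true), true), by simp [WedgeInc, hk']⟩,
        ⟨((0, true), true), by simp [WedgeInc, hk']⟩⟩
    · exact ⟨⟨((0, σ 0), false), by simp [WedgeInc]⟩, ⟨((0, σ 0), true), by simp [WedgeInc, hk']⟩⟩

/-- When `k = 0` the apex lies on `roof true` only, so the base and `roof false` are disjoint;
opposite sides are disjoint as well. This leaves `roof true` as the only candidate. -/
theorem not_hasTwoMeetingCoatoms_zero :
    ¬ HasTwoMeetingCoatoms (Concept (WedgePoint n) (WedgeFacet n) (WedgeInc 0)) := by
  rintro ⟨x, y, hne, hx, hy, hxy⟩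
  let f : WedgeFacet n → Concept (WedgePoint n) (WedgeFacet n) (WedgeInc 0) := fun j =>
    Concept.ofIsExtent (WedgeInc 0) _ (Order.isExtent_lowerPolar (t := {j}))
  have hf : ∀ j, (f j).extent = lowerPolar (WedgeInc 0) {j} := fun j => rfl
  have key : ∀ x : Concept (WedgePoint n) (WedgeFacet n) (WedgeInc 0), IsCoatom x →
      (∀ z, IsCoatom z → ¬ Disjoint x z) → x.extent = lowerPolar (WedgeInc 0) {.roof true} := by
    intro x hx hmeet
    obtain ⟨j, hj⟩ := (isCoatom_iff_exists_facet _).1 hx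
    have hmeet' : ∀ j', ∃ v, WedgeInc 0 v j ∧ WedgeInc 0 v j' := by
      intro j'
      have := hmeet (f j') ((isCoatom_iff_exists_facet _).2 ⟨_, hf _⟩)
      rw [disjoint_iff_forall_not_wedgeInc hj (hf _)] at this
      push Not at this
      exact this
    rcases j with _ | (_ | _) | σ
    · obtain ⟨⟨⟨i, s⟩, u⟩, h1, h2, h3⟩ := hmeet' (.roof false)
      cases u <;> cases s <;> simp_all [WedgeInc]
    · obtain ⟨⟨⟨i, s⟩, u⟩, ⟨h2, h3⟩, h1⟩ := hmeet' .base
      cases u <;> cases s <;> simp_all [WedgeInc]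
    · exact hj
    · obtain ⟨v, h1, h2⟩ := hmeet' (.side fun i => !(σ i))
      simp only [WedgeInc] at h1 h2
      rw [h1] at h2
      simp at h2
  exact hne (Concept.ext ((key x hx fun z hz => (hxy z hz).1).trans
    (key y hy fun z hz => (hxy z hz).2).symm))

end NotIso

/-! ### Coordinates and wedges with a given roof. -/

/-- The point of `ℝ^(m+1)` with first coordinates `y` and last coordinate `t`. -/
def heightVec {m : ℕ} (y : Fin m → ℝ) (t : ℝ) : EuclideanSpace ℝ (Fin (m + 1)) :=
  WithLp.toLp 2 (Fin.snoc y t : Fin (m + 1) → ℝ)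

/-- The sign `±1` of a Boolean. -/
def boolSign (s : Bool) : ℝ := if s then 1 else -1

@[simp] theorem boolSign_true : boolSign true = 1 := rfl

@[simp] theorem boolSign_false : boolSign false = -1 := rfl

section HeightVec

variable {m : ℕ}

@[simp] theorem heightVec_castSucc (y : Fin m → ℝ) (t : ℝ) (i : Fin m) :
    heightVec y t i.castSucc = y i := by simp [heightVec]

@[simp] theorem heightVec_last (y : Fin m → ℝ) (t : ℝ) :
    heightVec y t (Fin.last m) = t := by simp [heightVec]

theorem heightVec_inj {y y' : Fin m → ℝ} {t t' : ℝ} :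
    heightVec y t = heightVec y' t' ↔ y = y' ∧ t = t' := by
  refine ⟨fun h => ⟨funext fun i => ?_, ?_⟩, fun h => by rw [h.1, h.2]⟩
  · rw [← heightVec_castSucc y t, h, heightVec_castSucc]
  · rw [← heightVec_last y t, h, heightVec_last]

theorem eq_heightVec_iff {x : EuclideanSpace ℝ (Fin (m + 1))} {y : Fin m → ℝ} {t : ℝ} :
    x = heightVec y t ↔ (∀ i, x (Fin.castSucc i) = y i) ∧ x (Fin.last m) = t := by
  refine ⟨fun h => by simp [h], fun h => ?_⟩
  ext i
  refine Fin.lastCases ?_ (fun i => ?_) i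
  · simp [h.2]
  · simp [h.1]

theorem exists_eq_heightVec (x : EuclideanSpace ℝ (Fin (m + 1))) :
    ∃ y t, x = heightVec y t :=
  ⟨_, _, eq_heightVec_iff.2 ⟨fun _ => rfl, rfl⟩⟩

theorem inner_heightVec (y y' : Fin m → ℝ) (t t' : ℝ) :
    inner ℝ (heightVec y t) (heightVec y' t') = ∑ i, y i * y' i + t * t' := by
  simp [PiLp.inner_apply, Fin.sum_univ_castSucc, mul_comm]

end HeightVec

/-- A convex set is closed under convex combinations with the slack on a fixed point. -/
theorem Convex.sum_smul_add_mem {E ι : Type*} [AddCommGroup E] [Module ℝ E] [Fintype ι]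
    {C : Set E} (hC : Convex ℝ C) {w : ι → ℝ} {z : ι → E} {z₀ : E} (hw : ∀ i, 0 ≤ w i)
    (hle : ∑ i, w i ≤ 1) (hz : ∀ i, z i ∈ C) (hz₀ : z₀ ∈ C) :
    ∑ i, w i • z i + (1 - ∑ i, w i) • z₀ ∈ C := by
  have := hC.sum_mem (t := (Finset.univ : Finset (Option ι)))
    (w := fun o => o.elim (1 - ∑ i, w i) w) (z := fun o => o.elim z₀ z)
    (by rintro (_ | i) - <;> simp [hw, hle])
    (by simp [Fintype.sum_option])
    (by rintro (_ | i) - <;> simp [hz, hz₀])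
  rw [Fintype.sum_option] at this
  simpa [add_comm] using this

section Wedge

variable {n : ℕ}

/-- The coefficients of the two linear functions whose minimum, increased by one, is the height of
the roof; they differ at `k` only, and the roof meets the base in the vertex `(0, true)` only. -/
structure IsRoof (k : Fin (n + 2)) (g : Bool → Fin (n + 2) → ℝ) : Prop where
  eq_of_ne : ∀ i, i ≠ k → g true i = g false i
  lt : g true k < g false k
  apex : 1 + g true 0 = 0
  pos : ∀ i s, (i, s) ≠ (0, true) → 0 < 1 + boolSign s * g s i

/-- The points generating the wedge with given roof. -/
def wedgePoint (g : Bool → Fin (n + 2) → ℝ) (v : WedgePoint n) : EuclideanSpace ℝ (Fin (n + 3)) :=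
  heightVec (Pi.single v.1.1 (boolSign v.1.2))
    (if v.2 then 1 + boolSign v.1.2 * g v.1.2 v.1.1 else 0)

/-- The normal vectors of the facets of the wedge with given roof. -/
def wedgeNormal (g : Bool → Fin (n + 2) → ℝ) : WedgeFacet n → EuclideanSpace ℝ (Fin (n + 3))
  | .base => heightVec 0 (-1)
  | .roof b => heightVec (-g b) 1
  | .side σ => heightVec (fun i => boolSign (σ i)) 0

/-- The right-hand sides of the facet inequalities of a wedge. -/
def wedgeBound : WedgeFacet n → ℝ
  | .base => 0
  | .roof _ => 1
  | .side _ => 1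

variable {k : Fin (n + 2)} {g : Bool → Fin (n + 2) → ℝ}

namespace IsRoof

theorem apply_eq (h : IsRoof k g) {i : Fin (n + 2)} {s b : Bool} (hi : i = k → s = b) :
    g b i = g s i := by
  by_cases hk : i = k
  · rw [hi hk]
  · have := h.eq_of_ne i hk
    cases s <;> cases b <;> simp [this]

theorem sign_mul_lt (h : IsRoof k g) {s b : Bool} (hs : s ≠ b) :
    boolSign s * g s k < boolSign s * g b k := by
  have := h.lt
  cases s <;> cases b <;> simp_all

theorem height_eq_zero_iff (h : IsRoof k g) (i : Fin (n + 2)) (s : Bool) :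
    1 + boolSign s * g s i = 0 ↔ (i, s) = (0, true) := by
  refine ⟨fun h0 => ?_, fun hi => ?_⟩
  · by_contra hne
    exact (h.pos i s hne).ne' h0
  · obtain ⟨rfl, rfl⟩ := Prod.mk.inj hi
    simpa using h.apex

theorem height_nonneg (h : IsRoof k g) (i : Fin (n + 2)) (s : Bool) :
    0 ≤ 1 + boolSign s * g s i := by
  by_cases hi : (i, s) = (0, true)
  · exact ((h.height_eq_zero_iff i s).2 hi).ge
  · exact (h.pos i s hi).le

end IsRoof

theorem inner_wedgePoint (y : Fin (n + 2) → ℝ) (t : ℝ) (v : WedgePoint n) :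
    inner ℝ (heightVec y t) (wedgePoint g v) = y v.1.1 * boolSign v.1.2 +
      t * (if v.2 then 1 + boolSign v.1.2 * g v.1.2 v.1.1 else 0) := by
  rw [wedgePoint, inner_heightVec, Finset.sum_eq_single v.1.1] <;> simp +contextual

/-- A top point lies on the affine function of its own sign. The two functions agree there unless
its coordinate is `k`, in which case the other one is strictly higher by `lt`. -/
theorem inner_wedgeNormal_wedgePoint (h : IsRoof k g) (v : WedgePoint n) (j : WedgeFacet n) :
    inner ℝ (wedgeNormal g j) (wedgePoint g v) ≤ wedgeBound j ∧
      (WedgeInc k v j ↔ inner ℝ (wedgeNormal g j) (wedgePoint g v) = wedgeBound j) := by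
  obtain ⟨⟨i, s⟩, u⟩ := v
  have h0 := h.height_nonneg i s
  have h0' := h.height_eq_zero_iff i s
  rcases j with _ | b | σ
  · rw [wedgeNormal, inner_wedgePoint, wedgeBound, WedgeInc]
    simp only [← h0', Pi.zero_apply]
    cases u
    · simp
    · simp only [Bool.true_eq_false, false_or, if_true]
      exact ⟨by linarith, fun h => by linarith, fun h => by linarith⟩
  · rw [wedgeNormal, inner_wedgePoint, wedgeBound, WedgeInc]
    simp only [← h0', Pi.neg_apply]
    by_cases hi : i = k → s = b
    · rw [h.apply_eq hi, and_iff_left hi]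
      cases u
      · simp only [Bool.false_eq_true, false_or, if_false]
        exact ⟨by linarith, fun h => by linarith, fun h => by linarith⟩
      · simp only [true_or, if_true, true_iff]
        exact ⟨by linarith, by ring⟩
    · rw [iff_false_left fun h => hi h.2]
      push Not at hi
      obtain ⟨rfl, hs⟩ := hi
      have := h.sign_mul_lt hs
      cases u
      · simp only [Bool.false_eq_true, if_false]
        exact ⟨by linarith, fun h => by linarith⟩
      · simp only [if_true]
        exact ⟨by linarith, fun h => by linarith⟩
  · rw [wedgeNormal, inner_wedgePoint, wedgeBound, WedgeInc]
    cases hσ : σ i <;> cases s <;> simp <;> norm_num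

/-- The point lies on the vertical segment from `(y, 0)` to `(y, T)`, with `T` the height of the
roof above `y`. Each endpoint is a combination of the points in the orthant of `y` with weights `|y
i|`, the remaining weight going to `(0, 0)` or `(0, 1)`. -/
theorem heightVec_mem_convexHull (h : IsRoof k g) {y : Fin (n + 2) → ℝ} {t : ℝ}
    (hx : ∀ j, inner ℝ (wedgeNormal g j) (heightVec y t) ≤ wedgeBound j) :
    heightVec y t ∈ convexHull ℝ (range (wedgePoint g)) := by
  have hC := convex_convexHull ℝ (range (wedgePoint g))
  have hmem : ∀ v, wedgePoint g v ∈ convexHull ℝ (range (wedgePoint g)) :=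
    fun v => subset_convexHull ℝ _ ⟨v, rfl⟩
  let σ : Fin (n + 2) → Bool := fun i => decide (0 ≤ y i)
  have hσ : ∀ i, |y i| * boolSign (σ i) = y i := by
    intro i
    by_cases hi : 0 ≤ y i
    · simp [σ, hi, abs_of_nonneg hi]
    · simp [σ, hi, abs_of_neg (not_le.1 hi)]
  have hσ' : ∀ i, boolSign (σ i) * y i = |y i| := by
    intro i
    by_cases hi : 0 ≤ y i
    · simp [σ, hi, abs_of_nonneg hi]
    · simp [σ, hi, abs_of_neg (not_le.1 hi)]
  have hsum : ∑ i, |y i| ≤ 1 := by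
    have := hx (.side σ)
    simpa [wedgeNormal, wedgeBound, inner_heightVec, hσ'] using this
  have ht0 : 0 ≤ t := by
    have := hx .base
    simpa [wedgeNormal, wedgeBound, inner_heightVec] using this
  set T := 1 + ∑ i, y i * g (σ i) i with hT
  have htT : t ≤ T := by
    have := hx (.roof (σ k))
    simp only [wedgeNormal, wedgeBound, inner_heightVec, Pi.neg_apply, one_mul, neg_mul,
      Finset.sum_neg_distrib] at this
    have he : ∑ i, g (σ k) i * y i = ∑ i, y i * g (σ i) i := Finset.sum_congr rfl fun i _ => by
      rw [h.apply_eq (i := i) (s := σ i) (b := σ k) (fun hi => by rw [hi]), mul_comm]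
    linarith
  obtain ⟨j, hj⟩ := exists_ne k
  -- Over a coordinate `j ≠ k` the two roof functions have the same coefficient, so the heights of
  -- antipodal top points average to `1`.
  have hmid : ∀ u : Bool, heightVec (0 : Fin (n + 2) → ℝ) (if u then 1 else 0) ∈
      convexHull ℝ (range (wedgePoint g)) := by
    intro u
    have := hC (hmem ((j, true), u)) (hmem ((j, false), u)) (by norm_num : (0 : ℝ) ≤ 1 / 2)
      (by norm_num : (0 : ℝ) ≤ 1 / 2) (by norm_num)
    convert this using 1
    symm
    rw [eq_heightVec_iff]
    have hg := h.eq_of_ne j hj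
    refine ⟨fun i => ?_, ?_⟩
    · by_cases hi : i = j
      · subst hi; simp [wedgePoint]
      · simp [wedgePoint, hi]
    · cases u
      · simp [wedgePoint]
      · simp [wedgePoint, hg]; ring
  have hlayer : ∀ u : Bool, heightVec y (if u then T else 0) ∈
      convexHull ℝ (range (wedgePoint g)) := by
    intro u
    have := hC.sum_smul_add_mem (fun i => abs_nonneg (y i)) hsum
      (fun i => hmem ((i, σ i), u)) (hmid u)
    convert this using 1
    symm
    rw [eq_heightVec_iff]
    refine ⟨fun i => ?_, ?_⟩
    · simp only [PiLp.add_apply, WithLp.ofLp_sum, Finset.sum_apply, PiLp.smul_apply, wedgePoint,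
        heightVec_castSucc, smul_eq_mul, Pi.zero_apply, mul_zero, add_zero]
      rw [Finset.sum_eq_single i]
      · simp [hσ]
      · intro b _ hb
        simp [hb.symm]
      · simp
    · simp only [PiLp.add_apply, WithLp.ofLp_sum, Finset.sum_apply, PiLp.smul_apply, wedgePoint,
        heightVec_last, smul_eq_mul]
      cases u
      · simp
      · simp only [if_true, mul_add, mul_one, Finset.sum_add_distrib, ← mul_assoc, hσ, hT]
        ring
  have hbot := hlayer false
  have htop := hlayer true
  simp only [if_true, Bool.false_eq_true, if_false] at hbot htop
  -- The segment degenerates when `T = 0`, and the ratio `t / T` is not available.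
  rcases (ht0.trans htT).eq_or_lt with hT0 | hT0
  · obtain rfl : t = 0 := by linarith
    exact hbot
  · have := hC hbot htop (a := 1 - t / T) (b := t / T)
      (by rw [sub_nonneg, div_le_one hT0]; exact htT) (by positivity) (by ring)
    convert this using 1
    symm
    rw [eq_heightVec_iff]
    refine ⟨fun i => ?_, ?_⟩
    · simp only [PiLp.add_apply, PiLp.smul_apply, heightVec_castSucc, smul_eq_mul]
      ring
    · simp only [PiLp.add_apply, PiLp.smul_apply, heightVec_last, smul_eq_mul]
      field_simp
      ring

theorem IsRoof.isDoubleDescription (h : IsRoof k g) :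
    IsDoubleDescription (wedgePoint g) (wedgeNormal g) wedgeBound (WedgeInc k) := by
  have hmem : ∀ x, x ∈ convexHull ℝ (range (wedgePoint g)) ↔
      ∀ j, inner ℝ (wedgeNormal g j) x ≤ wedgeBound j := by
    refine fun x => ⟨fun hx j => ?_, fun hx => ?_⟩
    · refine convexHull_min (t := {x | inner ℝ (wedgeNormal g j) x ≤ wedgeBound j}) ?_ ?_ hx
      · rintro _ ⟨v, rfl⟩
        exact (inner_wedgeNormal_wedgePoint h v j).1
      · exact convex_halfSpace_le (innerₛₗ ℝ (wedgeNormal g j)).isLinear _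
    · obtain ⟨y, t, rfl⟩ := exists_eq_heightVec x
      exact heightVec_mem_convexHull h hx
  refine ⟨hmem, fun v j => (inner_wedgeNormal_wedgePoint h v j).2, ?_,
    fun v => ⟨.side fun _ => !v.1.2, by simp [WedgeInc]⟩⟩
  rw [← interior_convexHull_nonempty_iff_affineSpan_eq_top]
  -- The point halfway between the centre of the base and the roof satisfies all inequalities
  -- strictly.
  refine ⟨heightVec 0 (1 / 2), mem_interior.2
    ⟨{x | ∀ j, inner ℝ (wedgeNormal g j) x < wedgeBound j},
      fun x hx => (hmem x).2 fun j => (hx j).le, ?_, ?_⟩⟩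
  · simp only [ofPred_forall]
    exact isOpen_iInter_of_finite fun j => isOpen_lt (by fun_prop) continuous_const
  · rintro (_ | b | σ) <;> 
      norm_num [wedgeNormal, wedgeBound, inner_heightVec]

end Wedge

/-! ### The two concrete polytopes as wedges. -/

section Concrete

variable {n : ℕ}

/-- The roof of the polytope `polytopeP`. -/
def roofP (b : Bool) (i : Fin (n + 2)) : ℝ := if i = 0 then (if b then -1 else 0) else 0

/-- The roof of the polytope `polytopeQ`. -/
noncomputable def roofQ (b : Bool) (i : Fin (n + 2)) : ℝ :=
  if i = 0 then -1 else if i = 1 then (if b then -1 / 2 else 0) else 0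

/-- The roof is `min (1 - y 0) 1`, with crease at `y 0 = 0`; above `-e_1` it has height `1`. -/
theorem isRoof_roofP : IsRoof (n := n) 0 roofP where
  eq_of_ne i hi := by simp [roofP, hi]
  lt := by simp [roofP]
  apex := by simp [roofP]
  pos i s h := by
    by_cases hi : i = 0
    · subst hi
      cases s <;> simp_all [roofP]
    · simp [roofP, hi]

/-- The roof is `min (1 - y 0 - y 1 / 2) (1 - y 0)`, with crease at `y 1 = 0`; it has height `2`
above `-e_1` and `1 / 2` above `e_2`. -/
theorem isRoof_roofQ : IsRoof (n := n) 1 roofQ where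
  eq_of_ne i hi := by simp [roofQ, hi]
  lt := by norm_num [roofQ]
  apex := by simp [roofQ]
  pos i s h := by
    by_cases hi : i = 0
    · subst hi
      cases s <;> simp_all [roofQ]
    · by_cases hi' : i = 1
      · subst hi'
        cases s <;> simp [roofQ]
        norm_num
      · simp [roofQ, hi, hi']

theorem stdVec_eq_heightVec (i : Fin (n + 2)) :
    stdVec (n + 3) (i + 1) = heightVec (Pi.single i 1) 0 := by
  rw [eq_heightVec_iff]
  refine ⟨fun j => ?_, ?_⟩
  · simp [stdVec, Pi.single_apply, Fin.ext_iff]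
  · have := i.2
    simp [stdVec]
    omega

theorem stdVec_last : stdVec (n + 3) (n + 3) = heightVec 0 1 := by
  rw [eq_heightVec_iff]
  refine ⟨fun j => ?_, by simp [stdVec]⟩
  have := j.2
  simp [stdVec]
  omega

theorem heightVec_add {m : ℕ} (y y' : Fin m → ℝ) (t t' : ℝ) :
    heightVec y t + heightVec y' t' = heightVec (y + y') (t + t') := by
  simp [eq_heightVec_iff]

theorem heightVec_neg {m : ℕ} (y : Fin m → ℝ) (t : ℝ) :
    -heightVec y t = heightVec (-y) (-t) := by
  simp [eq_heightVec_iff]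

theorem heightVec_smul {m : ℕ} (r : ℝ) (y : Fin m → ℝ) (t : ℝ) :
    r • heightVec y t = heightVec (r • y) (r * t) := by
  simp [eq_heightVec_iff]

theorem stdVec_one : stdVec (n + 3) 1 = heightVec (Pi.single 0 1) 0 := stdVec_eq_heightVec 0

theorem stdVec_two : stdVec (n + 3) 2 = heightVec (Pi.single 1 1) 0 := stdVec_eq_heightVec 1

theorem mem_baseVertices_iff (v : EuclideanSpace ℝ (Fin (n + 3))) :
    v ∈ baseVertices (n + 3) ↔ ∃ i s, v = heightVec (Pi.single i (boolSign s)) 0 := by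
  constructor
  · rintro ⟨i, h1, h2, hv⟩
    obtain ⟨j, rfl⟩ : ∃ j : Fin (n + 2), i = j + 1 := ⟨⟨i - 1, by omega⟩, by simp; omega⟩
    rw [stdVec_eq_heightVec, heightVec_neg, ← Pi.single_neg, neg_zero] at hv
    rcases hv with rfl | rfl
    · exact ⟨j, true, rfl⟩
    · exact ⟨j, false, rfl⟩
  · rintro ⟨i, s, rfl⟩
    have := i.2
    refine ⟨i + 1, by omega, by omega, ?_⟩
    rw [stdVec_eq_heightVec, heightVec_neg, ← Pi.single_neg, neg_zero]
    cases s <;> simp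

theorem mem_topVertices_iff (v : EuclideanSpace ℝ (Fin (n + 3))) :
    v ∈ topVertices (n + 3) ↔ v = heightVec (Pi.single 0 1) 0 ∨ v = heightVec (Pi.single 0 (-1)) 2 ∨
      ∃ i s, i ≠ 0 ∧ v = heightVec (Pi.single i (boolSign s)) 1 := by
  simp only [topVertices, mem_union, mem_insert_iff, mem_singleton_iff, mem_ofPred_eq, or_assoc,
    stdVec_one, stdVec_last, sub_eq_add_neg, heightVec_neg, heightVec_smul, heightVec_add,
    ← Pi.single_neg, smul_zero, zero_add, neg_zero, mul_one, add_zero]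
  refine or_congr_right (or_congr_right ⟨?_, ?_⟩)
  · rintro ⟨i, h1, h2, hv⟩
    obtain ⟨j, rfl⟩ : ∃ j : Fin (n + 2), i = j + 1 := ⟨⟨i - 1, by omega⟩, by simp; omega⟩
    have hj : j ≠ 0 := by rintro rfl; simp at h1
    simp only [stdVec_eq_heightVec, heightVec_neg, heightVec_add, ← Pi.single_neg, zero_add,
      neg_zero, add_zero] at hv
    rcases hv with rfl | rfl
    · exact ⟨j, true, hj, rfl⟩
    · exact ⟨j, false, hj, rfl⟩
  · rintro ⟨i, s, hi, rfl⟩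
    have := i.2
    have hi' : (i : ℕ) ≠ 0 := fun h => hi (Fin.ext h)
    refine ⟨i + 1, by omega, by omega, ?_⟩
    simp only [stdVec_eq_heightVec, heightVec_neg, heightVec_add, ← Pi.single_neg, zero_add,
      neg_zero, add_zero]
    cases s <;> simp

theorem polytopeP_eq : polytopeP (n + 3) = convexHull ℝ (range (wedgePoint (n := n) roofP)) := by
  have hnew : stdVec (n + 3) (n + 3) - stdVec (n + 3) 1 = heightVec (Pi.single 0 (-1)) 1 := by
    simp [stdVec_last, stdVec_one, sub_eq_add_neg, heightVec_neg, heightVec_add, ← Pi.single_neg]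
  have hold : (2 : ℝ) • stdVec (n + 3) (n + 3) - stdVec (n + 3) 1 =
      heightVec (Pi.single 0 (-1)) 2 := by
    simp [stdVec_last, stdVec_one, sub_eq_add_neg, heightVec_neg, heightVec_add, heightVec_smul,
      ← Pi.single_neg]
  rw [polytopeP, hnew, hold]
  congr 1
  ext v
  rw [mem_insert_iff, mem_sdiff, mem_singleton_iff, wedgeVertices, mem_union, mem_baseVertices_iff,
    mem_topVertices_iff]
  constructor
  · rintro (rfl | ⟨⟨i, s, rfl⟩ | rfl | rfl | ⟨i, s, hi, rfl⟩, hne⟩)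
    · exact ⟨((0, false), true), by simp [wedgePoint, roofP]⟩
    · exact ⟨((i, s), false), by simp [wedgePoint]⟩
    · exact ⟨((0, true), false), by simp [wedgePoint]⟩
    · exact absurd rfl hne
    · exact ⟨((i, s), true), by simp [wedgePoint, roofP, hi]⟩
  · rintro ⟨⟨⟨i, s⟩, _ | _⟩, rfl⟩
    · refine Or.inr ⟨Or.inl ⟨i, s, by simp [wedgePoint]⟩, ?_⟩
      simp [wedgePoint, heightVec_inj]
    · by_cases hi : i = 0
      · subst hi
        cases s
        · left
          simp [wedgePoint, roofP]
        · refine Or.inr ⟨Or.inr (Or.inl ?_), ?_⟩ <;> simp [wedgePoint, roofP, heightVec_inj]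
      · refine Or.inr ⟨Or.inr (Or.inr (Or.inr ⟨i, s, hi, ?_⟩)), ?_⟩ <;>
          simp [wedgePoint, roofP, hi, heightVec_inj]

theorem polytopeQ_eq : polytopeQ (n + 3) = convexHull ℝ (range (wedgePoint (n := n) roofQ)) := by
  have hnew : (1 / 2 : ℝ) • stdVec (n + 3) (n + 3) + stdVec (n + 3) 2 =
      heightVec (Pi.single 1 1) (1 / 2) := by
    simp [stdVec_last, stdVec_two, heightVec_add, heightVec_smul]
  have hold : stdVec (n + 3) (n + 3) + stdVec (n + 3) 2 = heightVec (Pi.single 1 1) 1 := by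
    simp [stdVec_last, stdVec_two, heightVec_add]
  have hsingle : ∀ (i : Fin (n + 2)) (s : Bool),
      (Pi.single i (boolSign s) : Fin (n + 2) → ℝ) = Pi.single 1 1 → i = 1 ∧ s = true := by
    intro i s h
    by_cases hi : i = 1
    · subst hi
      refine ⟨rfl, ?_⟩
      have := congrFun h 1
      cases s
      · norm_num at this
      · rfl
    · have := congrFun h 1
      simp [Ne.symm hi] at this
  rw [polytopeQ, hnew, hold]
  congr 1
  ext v
  rw [mem_insert_iff, mem_sdiff, mem_singleton_iff, wedgeVertices, mem_union, mem_baseVertices_iff,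
    mem_topVertices_iff]
  constructor
  · rintro (rfl | ⟨⟨i, s, rfl⟩ | rfl | rfl | ⟨i, s, hi, rfl⟩, hne⟩)
    · exact ⟨((1, true), true), by simp [wedgePoint, roofQ]; norm_num⟩
    · exact ⟨((i, s), false), by simp [wedgePoint]⟩
    · exact ⟨((0, true), false), by simp [wedgePoint]⟩
    · exact ⟨((0, false), true), by simp [wedgePoint, roofQ]; norm_num⟩
    · refine ⟨((i, s), true), ?_⟩
      by_cases hi' : i = 1
      · subst hi'
        cases s
        · simp [wedgePoint, roofQ]
        · exact absurd rfl hne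
      · simp [wedgePoint, roofQ, hi, hi']
  · rintro ⟨⟨⟨i, s⟩, _ | _⟩, rfl⟩
    · refine Or.inr ⟨Or.inl ⟨i, s, by simp [wedgePoint]⟩, ?_⟩
      simp [wedgePoint, heightVec_inj]
    · by_cases hi : i = 0
      · subst hi
        cases s
        · refine Or.inr ⟨Or.inr (Or.inr (Or.inl ?_)), ?_⟩ <;>
            norm_num [wedgePoint, roofQ, heightVec_inj]
        · refine Or.inr ⟨Or.inr (Or.inl ?_), ?_⟩ <;> simp [wedgePoint, roofQ, heightVec_inj]
      · by_cases hi' : i = 1 ∧ s = true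
        · obtain ⟨rfl, rfl⟩ := hi'
          left
          simp [wedgePoint, roofQ]
          norm_num
        · refine Or.inr ⟨Or.inr (Or.inr (Or.inr ⟨i, s, hi, ?_⟩)), ?_⟩
          · by_cases h1 : i = 1
            · subst h1
              cases s <;> simp_all [wedgePoint, roofQ]
            · simp [wedgePoint, roofQ, hi, h1]
          · intro h
            exact hi' (hsingle i s (heightVec_inj.1 h).1)

end Concrete

/-! ### Graphs from skeleta. -/

section Graphs

variable {d : ℕ} {P Q : Set (EuclideanSpace ℝ (Fin d))}

theorem exists_equiv_of_skeleton_iso {l u : ℕ} (e : Skeleton P l u ≃o Skeleton Q l u)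
    (he : ∀ x m, l ≤ m → m ≤ u → (IsKFace P m x.1 ↔ IsKFace Q m (e x).1)) {m : ℕ} (hl : l ≤ m)
    (hu : m ≤ u) : ∃ f : {v // IsKFace P m v} ≃ {v // IsKFace Q m v},
      ∀ v, (f v).1 = (e ⟨v.1, m, hl, hu, v.2⟩).1 := by
  have hinv : ∀ y : Skeleton Q l u, IsKFace Q m y.1 → IsKFace P m (e.symm y).1 := fun y hy => by
    rw [he _ m hl hu, e.apply_symm_apply]
    exact hy
  exact ⟨{ toFun := fun v => ⟨(e ⟨v.1, m, hl, hu, v.2⟩).1, (he _ m hl hu).1 v.2⟩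
           invFun := fun v => ⟨(e.symm ⟨v.1, m, hl, hu, v.2⟩).1, hinv _ v.2⟩
           left_inv := fun v => by simp
           right_inv := fun v => by simp }, fun v => rfl⟩

theorem nonempty_vertexEdgeGraph_iso (e : Skeleton P 0 1 ≃o Skeleton Q 0 1)
    (he : ∀ x m, 0 ≤ m → m ≤ 1 → (IsKFace P m x.1 ↔ IsKFace Q m (e x).1)) :
    Nonempty (vertexEdgeGraph P ≃g vertexEdgeGraph Q) := by
  obtain ⟨f₀, hf₀⟩ := exists_equiv_of_skeleton_iso e he le_rfl zero_le_one
  obtain ⟨f₁, hf₁⟩ := exists_equiv_of_skeleton_iso e he zero_le_one le_rfl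
  have hle : ∀ (v : {v // IsKFace P 0 v}) (w : {v // IsKFace P 1 v}),
      (f₀ v).1 ⊆ (f₁ w).1 ↔ v.1 ⊆ w.1 := by
    intro v w
    rw [hf₀, hf₁]
    exact e.le_iff_le
  refine ⟨f₀, fun {v w} => and_congr f₀.injective.ne_iff ⟨?_, ?_⟩⟩
  · rintro ⟨x, hx, h1, h2⟩
    obtain ⟨y, hy⟩ := f₁.surjective ⟨x, hx⟩
    obtain rfl : (f₁ y).1 = x := congrArg Subtype.val hy
    exact ⟨y.1, y.2, (hle _ _).1 h1, (hle _ _).1 h2⟩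
  · rintro ⟨x, hx, h1, h2⟩
    exact ⟨_, (f₁ ⟨x, hx⟩).2, (hle _ ⟨x, hx⟩).2 h1, (hle _ ⟨x, hx⟩).2 h2⟩

theorem nonempty_facetRidgeGraph_iso {l : ℕ} (hl : l ≤ d - 2)
    (e : Skeleton P l (d - 1) ≃o Skeleton Q l (d - 1))
    (he : ∀ x m, l ≤ m → m ≤ d - 1 → (IsKFace P m x.1 ↔ IsKFace Q m (e x).1)) :
    Nonempty (facetRidgeGraph P ≃g facetRidgeGraph Q) := by
  obtain ⟨f₀, hf₀⟩ := exists_equiv_of_skeleton_iso e he (m := d - 1) (by omega) le_rfl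
  obtain ⟨f₁, hf₁⟩ := exists_equiv_of_skeleton_iso e he (m := d - 2) hl (by omega)
  have hle : ∀ (v : {v // IsKFace P (d - 1) v}) (w : {v // IsKFace P (d - 2) v}),
      (f₁ w).1 ⊆ (f₀ v).1 ↔ w.1 ⊆ v.1 := by
    intro v w
    rw [hf₀, hf₁]
    exact e.le_iff_le
  refine ⟨f₀, fun {v w} => and_congr f₀.injective.ne_iff ⟨?_, ?_⟩⟩
  · rintro ⟨x, hx, h1, h2⟩
    obtain ⟨y, hy⟩ := f₁.surjective ⟨x, hx⟩
    obtain rfl : (f₁ y).1 = x := congrArg Subtype.val hy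
    exact ⟨y.1, y.2, (hle _ _).1 h1, (hle _ _).1 h2⟩
  · rintro ⟨x, hx, h1, h2⟩
    exact ⟨_, (f₁ ⟨x, hx⟩).2, (hle _ ⟨x, hx⟩).2 h1, (hle _ ⟨x, hx⟩).2 h2⟩

end Graphs

theorem not_nonempty_facePoset_iso (n : ℕ) :
    ¬ Nonempty (FacePoset (polytopeP (n + 3)) ≃o FacePoset (polytopeQ (n + 3))) := by
  rw [polytopeP_eq, polytopeQ_eq]
  rintro ⟨e⟩
  have hP := (isRoof_roofP (n := n)).isDoubleDescription
  have hQ := (isRoof_roofQ (n := n)).isDoubleDescription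
  refine not_hasTwoMeetingCoatoms_zero ((hasTwoMeetingCoatoms_of_ne_zero (n := n) (k := 1)
    one_ne_zero).of_orderIso (((hP.facePosetIso (by omega)).trans e).trans
      (hQ.facePosetIso (by omega)).symm).symm)

theorem theorem4p4 :
    (∀ d : ℕ, 3 ≤ d →
      IsPolytope (polytopeP d) ∧ IsPolytope (polytopeQ d) ∧
      Nonempty (Skeleton (polytopeP d) 0 (d - 3) ≃o Skeleton (polytopeQ d) 0 (d - 3)) ∧
      Nonempty (Skeleton (polytopeP d) 2 (d - 1) ≃o Skeleton (polytopeQ d) 2 (d - 1)) ∧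
      ¬ Nonempty (FacePoset (polytopeP d) ≃o FacePoset (polytopeQ d))) ∧
    ¬ ∀ P Q : Set (EuclideanSpace ℝ (Fin 4)), IsPolytope P → IsPolytope Q →
      Nonempty (vertexEdgeGraph P ≃g vertexEdgeGraph Q) →
      Nonempty (facetRidgeGraph P ≃g facetRidgeGraph Q) →
      Nonempty (FacePoset P ≃o FacePoset Q) := by
  have hP := fun n : ℕ => (isRoof_roofP (n := n)).isDoubleDescription
  have hQ := fun n : ℕ => (isRoof_roofQ (n := n)).isDoubleDescription
  refine ⟨fun d hd => ?_, fun hall => ?_⟩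
  · obtain ⟨n, rfl⟩ := Nat.exists_eq_add_of_le' hd
    refine ⟨?_, ?_, ?_, ?_, not_nonempty_facePoset_iso n⟩
    · rw [polytopeP_eq]
      exact (hP n).isPolytope
    · rw [polytopeQ_eq]
      exact (hQ n).isPolytope
    · rw [polytopeP_eq, polytopeQ_eq]
      exact ⟨(exists_skeleton_iso_low (hP n) (hQ n)).choose⟩
    · rw [polytopeP_eq, polytopeQ_eq]
      exact ⟨(exists_skeleton_iso_high (hP n) (hQ n)).choose⟩
  -- For `d = 4` the two skeleta consist of dimensions `0, 1` and `2, 3`, which are exactly the data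
  -- of the two graphs.
  · refine not_nonempty_facePoset_iso 1 (hall (polytopeP 4) (polytopeQ 4) ?_ ?_ ?_ ?_)
    · exact polytopeP_eq (n := 1) ▸ (hP 1).isPolytope
    · exact polytopeQ_eq (n := 1) ▸ (hQ 1).isPolytope
    · rw [polytopeP_eq (n := 1), polytopeQ_eq (n := 1)]
      obtain ⟨e, he⟩ := exists_skeleton_iso_low (hP 1) (hQ 1)
      exact nonempty_vertexEdgeGraph_iso e he
    · rw [polytopeP_eq (n := 1), polytopeQ_eq (n := 1)]
      obtain ⟨e, he⟩ := exists_skeleton_iso_high (hP 1) (hQ 1)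
      exact nonempty_facetRidgeGraph_iso (l := 2) le_rfl e he
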